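/- Let $Q\in\mathbf R^{n\times n}$ be symmetric negative semidefinite, $c\in\mathbf R^n$, $q(x)=x^TQx+2c^Tx$, and let $X=\{x\in\mathbf R^n: Ax\le b\}$ be bounded with nonempty interior. For $S\subseteq\mathbf R^n$ let $\mathcal A_+(S)$ be the set of affine functions that are nonnegative on $S$. For $y\in\mathbf R^n$ and $d\in\mathbf R^n_+$ put $X(y,d)=\{x: y-d\le x\le y+d\}$ and let $\Phi(y,d)$ be the maximum of all $\ell\in\mathbf R$ for which there are $\alpha_i,\mu_i\in\mathcal A_+(X(y,d))$, $i=1,\dots,n$, with $$q(x)-\ell+\sum_{i=1}^n\big[\alpha_i(x)(x_i-y_i-d_i)+\mu_i(x)(-x_i+y_i-d_i)\big]\ \ge 0\quad\text{for all }x\in\mathbf R^n .$$ **(Properties of $\Phi$.)** The maximum exists for all $y\in\mathbf R^n$, $d\in\mathbf R^n_+$; $\Phi(y,0)=y^TQy+2c^Ty$ for all $y\in\mathbf R^n$; and $\Phi$ is continuous on $X\times\mathbf R^n_+$. **(The algorithm.)** Let $\epsilon>0$. The branch-and-cut algorithm for $\min_{x\in X}q(x)$ works in rounds on nodes $X_k=\{x:\bar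 Ax\le\bar b\}$. At first the only node is $X_1=X$, the upper bound is $u=+\infty$, and the list $L$ of lower bounds is empty. In a round every node $X_k$ at hand is processed, in any order, as follows. 1. Find an optimal solution $(\ell_k,\alpha)$ of: maximize $\ell\le u$ subject to $\alpha_i\in\mathcal A_+(X_k)$ and $q(x)-\ell+\sum_i\alpha_i(x)(\bar A_ix-\bar b_i)\ge0$ on $\mathbf R^n$. Put $\ell_k$ into $L$ and delete the bound of the father of $X_k$ from $L$. Let $g(x)=q(x)+\sum_i\alpha_i(x)(\bar A_ix-\bar b_i)$. For a minimizer $\hat x$ of $g$ over $X$, choose a vertex $\bar x$ of $X$ whose value $q(\bar x)$ is at most $q(\hat x)$ and at most the values of $q$ at the vertices of $X$ adjacent to $\bar x$. Replace $u$ by $\min(u,q(\bar x))$. 2. If $\ell_k+\epsilon\ge u$, the node is fathomed. Otherwise choose in the same way, with $X_k$ in place of $X$, a local optimal vertex $v$ of $X_k$, and replace $u$ by $\min(u,q(v))$. 3. If $v$ is a non-degenerate vertex, with extreme directions $e_1,\dots,e_n$ of $X_k$, and $\xi_i$ denote the coordinates given by $x=v+\sum_i\xi_ie_i$, put $t_i=\sup\{\theta: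 q(v+\theta e_i)\ge u-\epsilon\}\in(0,\infty]$ and choose minimizers $y^1,\dots,y^n$ of $2(Qv+c)^Ty$ over $\{y\in X:\sum_i\xi_i/t_i\ge1\}$, if these exist. If $\min_iq(y^i)\ge u-\epsilon$ ($v$ is eligible), Konno's cut $\sum_i\xi_i/s_i\ge1$ is added to $X_k$. Here $s_i\in(0,\infty]$ is the supremum of the $\theta\in\mathbf R$ for which there are $\lambda\ge0$, $\mu\ge0$ with $-A^T\lambda+\mu a-\theta Qe_i=Qv+c$ and $q(v)-(b-Av)^T\lambda+\mu+\theta(Qv+c)^Te_i\ge u-\epsilon$, where $a$ is given by $a^Te_j=1/t_j$ for all $j$ (and the cut is made only if all $s_i>0$; $1/\infty=0$). In all other cases $X_k$ is left as it is. 4. If now $X_k\ne\emptyset$, take a Chebyshev center $x_c$ of $X_k$ and an arbitrary $d\ne0$, and pass on the two nodes $\{x\in X_k:d^Tx\le d^Tx_c\}$ and $\{x\in X_k:d^Tx\ge d^Tx_c\}$ to the next round. After a round the lower bound is $l=\min L$. The algorithm has to stop if no nodes were passed on, it may stop if $u-l\le\epsilon$, and otherwise the next round begins. **(Finite convergence.)**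 Whatever choices are made, the algorithm can always carry out its next step until it stops. If the branching is such that the Euclidean diameters of the generated polytopes $X_1,X_2,\dots$ tend to zero (as long as there are infinitely many of them), then the algorithm stops after finitely many steps, and when it stops, $u=q(x)$ for some $x\in X$ with $q(x)\le\min_Xq+\epsilon$. -/

import Mathlib

open Set Filter Topology

noncomputable section

namespace ConcaveQP

/-! ### Quadratic programs, polytopes and the affine-multiplier bound -/

/-- The polyhedron `{x | A x ≤ b}`. -/
def polyhedron {n m : ℕ} (A : Matrix (Fin m) (Fin n) ℝ) (b : Fin m → ℝ) : Set (Fin n → ℝ) :=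
  {x | ∀ i, (A.mulVec x) i ≤ b i}

/-- The objective function `q(x) = xᵀ Q x + 2 cᵀ x`. -/
def quad {n : ℕ} (Q : Matrix (Fin n) (Fin n) ℝ) (c x : Fin n → ℝ) : ℝ :=
  x ⬝ᵥ Q.mulVec x + 2 * (c ⬝ᵥ x)

/-- An affine function `x ↦ aᵀ x + a₀` on `ℝⁿ`, stored as the pair `(a, a₀)`. -/
abbrev AffineFn (n : ℕ) : Type := (Fin n → ℝ) × ℝ

/-- The value of an affine function. -/
def affEval {n : ℕ} (α : AffineFn n) (x : Fin n → ℝ) : ℝ := α.1 ⬝ᵥ x + α.2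

/-- The set `𝒜₊(S)` of affine functions that are nonnegative on `S`. -/
def nonnegAffine {n : ℕ} (S : Set (Fin n → ℝ)) : Set (AffineFn n) :=
  {α | ∀ x ∈ S, 0 ≤ affEval α x}

/-- The quadratic function `q(x) + ∑ᵢ αᵢ(x) (Aᵢ x - bᵢ)`. -/
def penalized {n m : ℕ} (A : Matrix (Fin m) (Fin n) ℝ) (b : Fin m → ℝ)
    (Q : Matrix (Fin n) (Fin n) ℝ) (c : Fin n → ℝ) (α : Fin m → AffineFn n)
    (x : Fin n → ℝ) : ℝ :=
  quad Q c x + ∑ i, affEval (α i) x * ((A.mulVec x) i - b i)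

/-- `(ℓ, α)` is feasible for the bounding problem of `min q(x)` subject to `A x ≤ b`: the
multipliers `αᵢ` lie in `𝒜₊` of the feasible set, and
`q(x) - ℓ + ∑ᵢ αᵢ(x) (Aᵢ x - bᵢ)` is a nonnegative polynomial on `ℝⁿ`. -/
def BoundFeasible {n m : ℕ} (A : Matrix (Fin m) (Fin n) ℝ) (b : Fin m → ℝ)
    (Q : Matrix (Fin n) (Fin n) ℝ) (c : Fin n → ℝ) (l : ℝ) (α : Fin m → AffineFn n) : Prop :=
  (∀ i, α i ∈ nonnegAffine (polyhedron A b)) ∧ ∀ x, 0 ≤ penalized A b Q c α x - l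

/-- `(ℓ, α)` is optimal for: maximize `ℓ` over the feasible pairs with `ℓ ≤ u`. -/
def BoundOptimal {n m : ℕ} (A : Matrix (Fin m) (Fin n) ℝ) (b : Fin m → ℝ)
    (Q : Matrix (Fin n) (Fin n) ℝ) (c : Fin n → ℝ) (u : EReal) (l : ℝ)
    (α : Fin m → AffineFn n) : Prop :=
  BoundFeasible A b Q c l α ∧ (l : EReal) ≤ u ∧
    ∀ l' α', BoundFeasible A b Q c l' α' → (l' : EReal) ≤ u → l' ≤ l

/-! ### The box bound -/

/-- The box `X(y, d) = {x | y - d ≤ x ≤ y + d}`. -/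
def box {n : ℕ} (y d : Fin n → ℝ) : Set (Fin n → ℝ) := Icc (y - d) (y + d)

/-- The values `ℓ` that are feasible for the bounding problem over the box `X(y, d)`. -/
def boxFeasible {n : ℕ} (Q : Matrix (Fin n) (Fin n) ℝ) (c y d : Fin n → ℝ) : Set ℝ :=
  {l | ∃ α μ : Fin n → AffineFn n,
    (∀ i, α i ∈ nonnegAffine (box y d)) ∧ (∀ i, μ i ∈ nonnegAffine (box y d)) ∧
    ∀ x, 0 ≤ quad Q c x - l +
      ∑ i, (affEval (α i) x * (x i - y i - d i) + affEval (μ i) x * (-x i + y i - d i))}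

/-- The box bound `Φ(y, d)`. -/
def Phi {n : ℕ} (Q : Matrix (Fin n) (Fin n) ℝ) (c y d : Fin n → ℝ) : ℝ :=
  sSup (boxFeasible Q c y d)

/-! ### Vertices, Chebyshev centers, diameters -/

/-- `v` and `w` are adjacent vertices of `S`: the segment joining them is an edge. -/
def Adjacent {n : ℕ} (S : Set (Fin n → ℝ)) (v w : Fin n → ℝ) : Prop :=
  v ≠ w ∧ v ∈ S.extremePoints ℝ ∧ w ∈ S.extremePoints ℝ ∧ IsExtreme ℝ S (segment ℝ v w)

/-- `v` is a local optimal vertex for minimizing `f` over `S`. -/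
def LocalOptVertex {n : ℕ} (S : Set (Fin n → ℝ)) (f : (Fin n → ℝ) → ℝ) (v : Fin n → ℝ) : Prop :=
  v ∈ S.extremePoints ℝ ∧ ∀ w, Adjacent S v w → f v ≤ f w

/-- `v` is a local optimal vertex for `f` over `S`, at least as good as some minimizer over `S`
of the convex function `g`. -/
def FoundVertex {n : ℕ} (S : Set (Fin n → ℝ)) (g f : (Fin n → ℝ) → ℝ) (v : Fin n → ℝ) : Prop :=
  LocalOptVertex S f v ∧ ∃ z ∈ S, IsMinOn g S z ∧ f v ≤ f z

/-- The copy of a subset of `ℝⁿ` in the Euclidean space (with the Euclidean distance). -/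
def toEuclid {n : ℕ} (S : Set (Fin n → ℝ)) : Set (EuclideanSpace ℝ (Fin n)) :=
  WithLp.toLp 2 '' S

/-- `x` is a Chebyshev center of `S`: a point of `S` at maximal Euclidean distance from the
complement of `S`, i.e. the center of a largest Euclidean ball contained in `S`. -/
def IsChebyshevCenter {n : ℕ} (S : Set (Fin n → ℝ)) (x : Fin n → ℝ) : Prop :=
  x ∈ S ∧ ∀ z ∈ S, Metric.infDist (WithLp.toLp 2 z) (toEuclid S)ᶜ ≤
    Metric.infDist (WithLp.toLp 2 x) (toEuclid S)ᶜ

/-- The Euclidean diameter. -/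
def euclidDiam {n : ℕ} (S : Set (Fin n → ℝ)) : ℝ := Metric.diam (toEuclid S)

/-! ### Konno's cut

The cut is taken at a vertex `v`, with extreme directions `e₁, …, eₙ`; `ξ` denotes coordinates
with respect to them, `x = v + ∑ ξᵢ eᵢ`. In these coordinates `v` is the origin. -/

/-- `v` is a non-degenerate vertex of `S` with extreme directions `e₁, …, eₙ`. -/
def ExtremeDirections {n : ℕ} (S : Set (Fin n → ℝ)) (v : Fin n → ℝ)
    (e : Fin n → Fin n → ℝ) : Prop :=
  LinearIndependent ℝ e ∧ (∀ i, ∃ r : ℝ, 0 < r ∧ v + r • e i ∈ S) ∧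
    ∀ x ∈ S, ∃ ξ : Fin n → ℝ, (∀ i, 0 ≤ ξ i) ∧ x = v + ∑ i, ξ i • e i

/-- The vector `a` with `aᵀ eᵢ = 1 / sᵢ` for all `i` (where `1 / ∞ = 0`), so that
`aᵀ (x - v) = ∑ᵢ ξᵢ / sᵢ`. -/
def cutNormal {n : ℕ} (e : Fin n → Fin n → ℝ) (s : Fin n → EReal) : Fin n → ℝ :=
  (Matrix.of e)⁻¹.mulVec fun i => ((s i)⁻¹).toReal

/-- `tᵢ = max {θ | q(v + θ eᵢ) ≥ u - ε}`, possibly `∞`. -/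
def tuyStep {n : ℕ} (Q : Matrix (Fin n) (Fin n) ℝ) (c : Fin n → ℝ) (u ε : ℝ) (v : Fin n → ℝ)
    (e : Fin n → Fin n → ℝ) (i : Fin n) : EReal :=
  sSup ((fun θ : ℝ => (θ : EReal)) '' {θ | u - ε ≤ quad Q c (v + θ • e i)})

/-- The normal vector of Tuy's cut `∑ᵢ ξᵢ / tᵢ ≥ 1`. -/
def tuyNormal {n : ℕ} (Q : Matrix (Fin n) (Fin n) ℝ) (c : Fin n → ℝ) (u ε : ℝ) (v : Fin n → ℝ)
    (e : Fin n → Fin n → ℝ) : Fin n → ℝ :=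
  cutNormal e (tuyStep Q c u ε v e)

/-- The part of `{x | A x ≤ b}` that satisfies Tuy's cut. -/
def tuyRegion {n m : ℕ} (A : Matrix (Fin m) (Fin n) ℝ) (b : Fin m → ℝ)
    (Q : Matrix (Fin n) (Fin n) ℝ) (c : Fin n → ℝ) (u ε : ℝ) (v : Fin n → ℝ)
    (e : Fin n → Fin n → ℝ) : Set (Fin n → ℝ) :=
  {x ∈ polyhedron A b | 1 ≤ tuyNormal Q c u ε v e ⬝ᵥ (x - v)}

/-- `sᵢ`, the maximal `θ` for which there are `λ, μ ≥ 0` with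
`-Aᵀ λ + μ t⁻¹ - θ Q eᵢ = c` and `-bᵀ λ + μ + θ cᵢ ≥ u - ε`, possibly `∞`. The system is written
for the origin moved to `v`: there `c` becomes `Q v + c`, `b` becomes `b - A v`, and the objective
function gets the constant term `q(v)`. -/
def konnoStep {n m : ℕ} (A : Matrix (Fin m) (Fin n) ℝ) (b : Fin m → ℝ)
    (Q : Matrix (Fin n) (Fin n) ℝ) (c : Fin n → ℝ) (u ε : ℝ) (v : Fin n → ℝ)
    (e : Fin n → Fin n → ℝ) (i : Fin n) : EReal :=
  sSup ((fun θ : ℝ => (θ : EReal)) '' {θ | ∃ (lam : Fin m → ℝ) (μ : ℝ),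
    (∀ j, 0 ≤ lam j) ∧ 0 ≤ μ ∧
    -(A.transpose.mulVec lam) + μ • tuyNormal Q c u ε v e - θ • Q.mulVec (e i)
      = Q.mulVec v + c ∧
    u - ε ≤ quad Q c v - (b - A.mulVec v) ⬝ᵥ lam + μ + θ * ((Q.mulVec v + c) ⬝ᵥ e i)})

/-- The normal vector of Konno's cut `∑ᵢ ξᵢ / sᵢ ≥ 1`. -/
def konnoNormal {n m : ℕ} (A : Matrix (Fin m) (Fin n) ℝ) (b : Fin m → ℝ)
    (Q : Matrix (Fin n) (Fin n) ℝ) (c : Fin n → ℝ) (u ε : ℝ) (v : Fin n → ℝ)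
    (e : Fin n → Fin n → ℝ) : Fin n → ℝ :=
  cutNormal e (konnoStep A b Q c u ε v e)

/-- The data computed in the test for eligibility of the vertex `v` of `S`: extreme directions
`eᵢ` at `v`, and points `yⁱ` that minimize the linear part `2 (Q v + c)ᵀ y` of the objective
function at `v` over the part of `{x | A x ≤ b}` that satisfies Tuy's cut. -/
def KonnoData {n m : ℕ} (A : Matrix (Fin m) (Fin n) ℝ) (b : Fin m → ℝ)
    (Q : Matrix (Fin n) (Fin n) ℝ) (c : Fin n → ℝ) (S : Set (Fin n → ℝ)) (u ε : ℝ)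
    (v : Fin n → ℝ) (e y : Fin n → Fin n → ℝ) : Prop :=
  ExtremeDirections S v e ∧
    ∀ i, y i ∈ tuyRegion A b Q c u ε v e ∧
      IsMinOn (fun x => 2 * ((Q.mulVec v + c) ⬝ᵥ x)) (tuyRegion A b Q c u ε v e) (y i)

/-- The eligibility test `minᵢ q(yⁱ) ≥ u - ε`, together with the positivity of the `sᵢ`, without
which the cut would not be defined. -/
def Eligible {n m : ℕ} (A : Matrix (Fin m) (Fin n) ℝ) (b : Fin m → ℝ)
    (Q : Matrix (Fin n) (Fin n) ℝ) (c : Fin n → ℝ) (u ε : ℝ)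
    (v : Fin n → ℝ) (e y : Fin n → Fin n → ℝ) : Prop :=
  (∀ i, u - ε ≤ quad Q c (y i)) ∧ ∀ i, 0 < konnoStep A b Q c u ε v e i

/-! ### The branch-and-cut algorithm -/

/-- A node of the tree: its number, the number of its father (`0` for the root), and the system
`A x ≤ b` that defines its feasible set. -/
structure Node (n : ℕ) where
  id : ℕ
  father : ℕ
  m : ℕ
  A : Matrix (Fin m) (Fin n) ℝ
  b : Fin m → ℝ

/-- The feasible set of a node. -/
def Node.set {n : ℕ} (N : Node n) : Set (Fin n → ℝ) := polyhedron N.A N.b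

/-- The node with the inequality `aᵀ x ≤ β` added. -/
def Node.addIneq {n : ℕ} (N : Node n) (a : Fin n → ℝ) (β : ℝ) : Node n where
  id := N.id
  father := N.father
  m := N.m + 1
  A := Matrix.of (Fin.cons a fun i => N.A i)
  b := Fin.cons β N.b

/-- The child with number `k` of the node `N`, cut out by `aᵀ x ≤ β`. -/
def Node.child {n : ℕ} (N : Node n) (k : ℕ) (a : Fin n → ℝ) (β : ℝ) : Node n :=
  { N.addIneq a β with id := k, father := N.id }

/-- The cutting step at the vertex `v` of the node `N`: `N'` is `N` with Konno's cut added if `v`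
is found eligible, and `N` otherwise. Here `A`, `b` describe the feasible set of the root. -/
inductive CutStep {n m : ℕ} (A : Matrix (Fin m) (Fin n) ℝ) (b : Fin m → ℝ)
    (Q : Matrix (Fin n) (Fin n) ℝ) (c : Fin n → ℝ) (u ε : ℝ) (v : Fin n → ℝ) (N : Node n) :
    Node n → Prop
  | cut (e y : Fin n → Fin n → ℝ) (hdata : KonnoData A b Q c N.set u ε v e y)
      (helig : Eligible A b Q c u ε v e y) :
      CutStep A b Q c u ε v N
        (N.addIneq (-konnoNormal A b Q c u ε v e) (-(1 + konnoNormal A b Q c u ε v e ⬝ᵥ v)))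
  | keep (h : (∀ e y, KonnoData A b Q c N.set u ε v e y → ¬ Eligible A b Q c u ε v e y) ∨
      ∃ e y, KonnoData A b Q c N.set u ε v e y ∧ ¬ Eligible A b Q c u ε v e y) :
      CutStep A b Q c u ε v N N

/-- A state of the algorithm. -/
structure State (n : ℕ) where
  /-- the nodes still to be processed in the current round, `Π₁` -/
  active : Multiset (Node n)
  /-- the nodes generated for the next round, `Π₂` -/
  next : Multiset (Node n)
  /-- the list `L` of (node number, lower bound of the node) -/
  bounds : List (ℕ × ℝ)
  /-- the best upper bound `u` found so far -/
  upper : EReal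
  /-- the lower bound `l` -/
  lower : EReal
  /-- the number of nodes generated so far -/
  count : ℕ
  /-- `false` once the algorithm has stopped -/
  running : Bool

/-- The initial state. -/
def initState {n m : ℕ} (A : Matrix (Fin m) (Fin n) ℝ) (b : Fin m → ℝ) : State n where
  active := {⟨1, 0, m, A, b⟩}
  next := 0
  bounds := []
  upper := ⊤
  lower := ⊥
  count := 1
  running := true

/-- Enter the bound `l` of the node `N` in the list, and delete the bound of its father. -/
def updateBounds {n : ℕ} (L : List (ℕ × ℝ)) (N : Node n) (l : ℝ) : List (ℕ × ℝ) :=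
  (N.id, l) :: L.filter fun p => p.1 ≠ N.father

/-- The minimum of the bounds in the list. -/
def minBound (L : List (ℕ × ℝ)) : EReal := ⨅ p ∈ L, (p.2 : EReal)

/-- The bounding step for the node `N` with the current upper bound `u`: the bounding problem of
the node is solved, with optimal solution `(l, α)`, then the convex quadratic program is solved over
the feasible set of the root, and from its solution a local optimal vertex `v` is obtained;
`u₁` is the updated upper bound. -/
def Bounding {n m : ℕ} (A : Matrix (Fin m) (Fin n) ℝ) (b : Fin m → ℝ)
    (Q : Matrix (Fin n) (Fin n) ℝ) (c : Fin n → ℝ) (u : EReal) (N : Node n)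
    (l : ℝ) (α : Fin N.m → AffineFn n) (u₁ : ℝ) : Prop :=
  BoundOptimal N.A N.b Q c u l α ∧
    ∃ v, FoundVertex (polyhedron A b) (penalized N.A N.b Q c α) (quad Q c) v ∧
      (u₁ : EReal) = min u (quad Q c v : ℝ)

/-- The cutting phase for the node `N`: the convex quadratic program is solved over the feasible
set of the node, a local optimal vertex `v` of the node is obtained, `u₂` is the updated upper
bound, and the cutting step at `v` turns `N` into `N'`. -/
def Cutting {n m : ℕ} (A : Matrix (Fin m) (Fin n) ℝ) (b : Fin m → ℝ)
    (Q : Matrix (Fin n) (Fin n) ℝ) (c : Fin n → ℝ) (ε : ℝ) (u₁ : ℝ) (N : Node n)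
    (α : Fin N.m → AffineFn n) (u₂ : ℝ) (N' : Node n) : Prop :=
  ∃ v, FoundVertex N.set (penalized N.A N.b Q c α) (quad Q c) v ∧
    u₂ = min u₁ (quad Q c v) ∧ CutStep A b Q c u₂ ε v N N'

/-- One step of the algorithm: either one node of the current round is processed, or, when none is
left, the round is closed. -/
inductive Step {n m : ℕ} (A : Matrix (Fin m) (Fin n) ℝ) (b : Fin m → ℝ)
    (Q : Matrix (Fin n) (Fin n) ℝ) (c : Fin n → ℝ) (ε : ℝ) : State n → State n → Prop
  /-- the selected node is fathomed, because its bound is within `ε` of the upper bound -/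
  | fathom (σ : State n) (N : Node n) (rest : Multiset (Node n)) (l : ℝ)
      (α : Fin N.m → AffineFn n) (u₁ : ℝ)
      (hrun : σ.running = true) (hsel : σ.active = N ::ₘ rest)
      (hbound : Bounding A b Q c σ.upper N l α u₁) (htest : ¬ l + ε < u₁) :
      Step A b Q c ε σ
        { σ with active := rest, bounds := updateBounds σ.bounds N l, upper := u₁ }
  /-- the selected node is not fathomed, but becomes empty in the cutting step -/
  | emptied (σ : State n) (N : Node n) (rest : Multiset (Node n)) (l : ℝ)
      (α : Fin N.m → AffineFn n) (u₁ u₂ : ℝ) (N' : Node n)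
      (hrun : σ.running = true) (hsel : σ.active = N ::ₘ rest)
      (hbound : Bounding A b Q c σ.upper N l α u₁) (htest : l + ε < u₁)
      (hcut : Cutting A b Q c ε u₁ N α u₂ N') (hempty : N'.set = ∅) :
      Step A b Q c ε σ
        { σ with active := rest, bounds := updateBounds σ.bounds N l, upper := u₂ }
  /-- the selected node is split by a hyperplane through a Chebyshev center, in the direction of
  an arbitrary nonzero vector `d` -/
  | branch (σ : State n) (N : Node n) (rest : Multiset (Node n)) (l : ℝ)
      (α : Fin N.m → AffineFn n) (u₁ u₂ : ℝ) (N' : Node n) (x d : Fin n → ℝ)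
      (hrun : σ.running = true) (hsel : σ.active = N ::ₘ rest)
      (hbound : Bounding A b Q c σ.upper N l α u₁) (htest : l + ε < u₁)
      (hcut : Cutting A b Q c ε u₁ N α u₂ N') (hne : N'.set.Nonempty)
      (hcenter : IsChebyshevCenter N'.set x) (hd : d ≠ 0) :
      Step A b Q c ε σ
        { σ with
          active := rest
          next := N'.child (σ.count + 1) d (d ⬝ᵥ x) ::ₘ
            N'.child (σ.count + 2) (-d) (-(d ⬝ᵥ x)) ::ₘ σ.next
          bounds := updateBounds σ.bounds N l
          upper := u₂
          count := σ.count + 2 }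
  /-- the round is over, and the algorithm terminates: no node is left, or the gap is at most `ε` -/
  | halt (σ : State n) (hrun : σ.running = true) (hactive : σ.active = 0)
      (hhalt : σ.next = 0 ∨ σ.upper ≤ minBound σ.bounds + (ε : EReal)) :
      Step A b Q c ε σ { σ with lower := minBound σ.bounds, running := false }
  /-- the round is over, and the next one begins -/
  | nextRound (σ : State n) (hrun : σ.running = true) (hactive : σ.active = 0)
      (hnext : σ.next ≠ 0) :
      Step A b Q c ε σ
        { σ with active := σ.next, next := 0, lower := minBound σ.bounds }

/-- A run of the algorithm: it begins in the initial state and makes steps as long as it has not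
stopped; a stopped run is continued by repeating its final state. -/
def IsRun {n m : ℕ} (A : Matrix (Fin m) (Fin n) ℝ) (b : Fin m → ℝ)
    (Q : Matrix (Fin n) (Fin n) ℝ) (c : Fin n → ℝ) (ε : ℝ) (σ : ℕ → State n) : Prop :=
  σ 0 = initState A b ∧
    ∀ k, Step A b Q c ε (σ k) (σ (k + 1)) ∨ ((σ k).running = false ∧ σ (k + 1) = σ k)

/-- The diameters of the polytopes `X₁, X₂, …` generated in the run (in the order of generation)
tend to zero; this holds trivially if there are only finitely many of them. -/
def DiametersTendToZero {n : ℕ} (σ : ℕ → State n) : Prop :=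
  ∀ δ : ℝ, 0 < δ → ∃ K : ℕ, ∀ k, ∀ N ∈ (σ k).active + (σ k).next,
    K ≤ N.id → euclidDiam N.set < δ

end ConcaveQP

end

namespace ConcaveQP

section

/-! ### Farkas' lemma -/

/-! The bounding problem seeks the largest `ℓ` such that `q - ℓ` dominates a sum of products of a
constraint and a multiplier that is nonnegative on the feasible set; `Cert` names this relation. By
Farkas' lemma, every product of two affine functions nonnegative on a nonempty feasible set has such
a certificate (`cert_mul`). Hence the bound depends on the set and not on the inequalities
describing it, does not decrease when the set shrinks (`Cert.mono_set`), and can be transported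
along affine maps (`Cert.comp`).

The maximum is attained because the relevant multipliers form a compact set
(`IsQuad.exists_isGreatest_cert`). Flat feasible sets need care: multipliers of implicit equalities
are unbounded, so they are discarded, the problem is solved on the affine hull, and the solution is
lifted back by certified corrections.

For `Φ`, scaling the box to the cube `[-1, 1]ⁿ` leaves a fixed feasible set and a quadratic whose
coefficients are continuous in `(y, d)`. The bound changes by at most the sum of the absolute
changes of the coefficients (`Phi_le_add_boxModulus`), which gives continuity; for `d = 0` the
quadratic is constant, which gives exactness.

Correctness of the algorithm rests on an invariant (`Inv`): every feasible point either has value at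
least `u - ε` or lies in a pending node. Fathoming respects it by weak duality, and cutting because
Konno's cut removes only points of the first kind (`konno_cut_valid`).

Termination: before branching, `q` is evaluated at a vertex `v` of the father, so `u ≤ q(v)` from
then on. If the father is small, its sons lie in a small box around `v`, whose bound is at least
`q(v) - ε ≥ u - ε`, so the sons are fathomed (`Bounding.fathomed`). In a late round all fathers are
small; nothing is passed on, and the run must stop. -/

theorem farkas {ι V : Type*} [AddCommGroup V] [Module ℝ V] (s : Finset ι) :
    ∀ (f : ι → V →ₗ[ℝ] ℝ) (h : V →ₗ[ℝ] ℝ), (∀ x, (∀ i ∈ s, 0 ≤ f i x) → 0 ≤ h x) →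
      ∃ w : ι → ℝ, (∀ i, 0 ≤ w i) ∧ h = ∑ i ∈ s, w i • f i := by
  classical
  induction s using Finset.induction_on with
  | empty =>
    intro f h H
    refine ⟨0, fun _ => le_rfl, ?_⟩
    ext x
    have h1 := H x (by simp)
    have h2 := H (-x) (by simp)
    rw [map_neg] at h2
    simp only [Finset.sum_empty, LinearMap.zero_apply]
    linarith
  | insert a s ha ih =>
    intro f h H
    by_cases hs : ∀ x, (∀ i ∈ s, 0 ≤ f i x) → 0 ≤ h x
    · obtain ⟨w, hw, e⟩ := ih f h hs
      refine ⟨Function.update w a 0, fun i => ?_, ?_⟩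
      · by_cases hi : i = a
        · subst hi; simp
        · simp [hi, hw]
      · rw [Finset.sum_insert ha, e]
        simp only [Function.update_self, zero_smul, zero_add]
        refine Finset.sum_congr rfl fun i hi => ?_
        rw [Function.update_of_ne (ne_of_mem_of_not_mem hi ha)]
    · push Not at hs
      obtain ⟨x₁, hx₁, hneg⟩ := hs
      have hfa : f a x₁ < 0 := by
        by_contra hcon
        push Not at hcon
        refine absurd (H x₁ fun i hi => ?_) (not_le.2 hneg)
        rcases Finset.mem_insert.1 hi with rfl | hi
        · exact hcon
        · exact hx₁ i hi
      -- Normalized so that `f a x₀ = -1`: then `x ↦ x + f a x • x₀` projects onto the kernel of `f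
      -- a`. The induction hypothesis is applied to the functionals pulled back along this
      -- projection, and the resulting identity is solved for `h`.
      set x₀ : V := (-(f a x₁))⁻¹ • x₁ with hx₀
      have hpos : 0 < (-(f a x₁))⁻¹ := inv_pos.2 (by linarith)
      have h₀ : ∀ i ∈ s, 0 ≤ f i x₀ := fun i hi => by
        rw [hx₀, map_smul, smul_eq_mul]; exact mul_nonneg hpos.le (hx₁ i hi)
      have hh₀ : h x₀ < 0 := by
        rw [hx₀, map_smul, smul_eq_mul]; exact mul_neg_of_pos_of_neg hpos hneg
      have hf₀ : f a x₀ = -1 := by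
        rw [hx₀, map_smul, smul_eq_mul]; field_simp [hfa.ne]
      obtain ⟨w, hw, e⟩ := ih (fun i => f i + f i x₀ • f a) (h + h x₀ • f a) (by
        intro x hx
        have := H (x + f a x • x₀) (by
          intro i hi
          rcases Finset.mem_insert.1 hi with rfl | hi
          · simp [hf₀]
          · have := hx i hi
            simp only [LinearMap.add_apply, LinearMap.smul_apply, smul_eq_mul, map_add,
              map_smul] at this ⊢
            linarith [mul_comm (f i x₀) (f a x)])
        simp only [LinearMap.add_apply, LinearMap.smul_apply, smul_eq_mul, map_add,
          map_smul] at this ⊢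
        linarith [mul_comm (h x₀) (f a x)])
      have hsum : 0 ≤ ∑ i ∈ s, w i * f i x₀ :=
        Finset.sum_nonneg fun i hi => mul_nonneg (hw i) (h₀ i hi)
      refine ⟨Function.update w a (∑ i ∈ s, w i * f i x₀ - h x₀), fun i => ?_, ?_⟩
      · by_cases hi : i = a
        · subst hi; simp only [Function.update_self]; linarith
        · simp [hi, hw]
      · rw [Finset.sum_insert ha]
        have hcongr : ∑ i ∈ s, Function.update w a (∑ i ∈ s, w i * f i x₀ - h x₀) i • f i
            = ∑ i ∈ s, w i • f i := Finset.sum_congr rfl fun i hi => by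
          rw [Function.update_of_ne (ne_of_mem_of_not_mem hi ha)]
        rw [hcongr, Function.update_self]
        ext x
        have := LinearMap.congr_fun e x
        simp only [LinearMap.add_apply, LinearMap.smul_apply, smul_eq_mul, LinearMap.sum_apply,
          mul_add, Finset.sum_add_distrib] at this ⊢
        have h3 : ∑ i ∈ s, w i * (f i x₀ * f a x) = (∑ i ∈ s, w i * f i x₀) * f a x := by
          rw [Finset.sum_mul]; exact Finset.sum_congr rfl fun i _ => by ring
        rw [h3] at this
        linarith

/-! ### Affine functions -/

variable {n : ℕ}

@[simp] theorem affEval_add (α β : AffineFn n) (x : Fin n → ℝ) :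
    affEval (α + β) x = affEval α x + affEval β x := by
  simp [affEval, add_dotProduct]; ring

@[simp] theorem affEval_neg (α : AffineFn n) (x : Fin n → ℝ) :
    affEval (-α) x = -affEval α x := by
  simp [affEval]; ring

@[simp] theorem affEval_smul (r : ℝ) (α : AffineFn n) (x : Fin n → ℝ) :
    affEval (r • α) x = r * affEval α x := by
  simp [affEval]; ring

@[simp] theorem affEval_zero (x : Fin n → ℝ) : affEval 0 x = 0 := by simp [affEval]

@[simp] theorem affEval_const (r : ℝ) (x : Fin n → ℝ) : affEval (0, r) x = r := by
  simp [affEval]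

@[simp] theorem affEval_sum {ι : Type*} (s : Finset ι) (α : ι → AffineFn n) (x : Fin n → ℝ) :
    affEval (∑ i ∈ s, α i) x = ∑ i ∈ s, affEval (α i) x := by
  classical
  induction s using Finset.induction_on with
  | empty => simp
  | insert a s ha ih => simp [Finset.sum_insert ha, ih]

theorem affEval_add_arg (α : AffineFn n) (x h : Fin n → ℝ) :
    affEval α (x + h) = affEval α x + α.1 ⬝ᵥ h := by
  simp [affEval, dotProduct_add]; ring

@[fun_prop] theorem continuous_affEval (α : AffineFn n) : Continuous (affEval α) := by
  unfold affEval; fun_prop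

/-- The solution set of a system of affine inequalities `0 ≤ gᵢ(x)`. -/
def solSet {ι : Type*} (g : ι → AffineFn n) : Set (Fin n → ℝ) := {x | ∀ i, 0 ≤ affEval (g i) x}

/-- Homogenization: affine functions become linear functionals on `ℝⁿ × ℝ`, and the index `none`
stands for the extra constraint `0 ≤ s`, whose weight becomes the constant `w₀`. -/
theorem affine_farkas {ι : Type*} [Fintype ι] {g : ι → AffineFn n} (hne : (solSet g).Nonempty)
    {β : AffineFn n} (hβ : β ∈ nonnegAffine (solSet g)) :
    ∃ (w : ι → ℝ) (w₀ : ℝ), (∀ i, 0 ≤ w i) ∧ 0 ≤ w₀ ∧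
      ∀ x, affEval β x = ∑ i, w i * affEval (g i) x + w₀ := by
  classical
  obtain ⟨x₀, hx₀⟩ := hne
  let hom : AffineFn n → ((Fin n → ℝ) × ℝ →ₗ[ℝ] ℝ) := fun α =>
    { toFun := fun p => α.1 ⬝ᵥ p.1 + α.2 * p.2
      map_add' := fun p p' => by simp [dotProduct_add]; ring
      map_smul' := fun r p => by simp; ring }
  have hom_apply : ∀ α p, hom α p = α.1 ⬝ᵥ p.1 + α.2 * p.2 := fun _ _ => rfl
  let f : Option ι → ((Fin n → ℝ) × ℝ →ₗ[ℝ] ℝ) := fun o => o.elim (hom (0, 1)) fun i => hom (g i)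
  obtain ⟨w, hw, e⟩ := farkas (Finset.univ : Finset (Option ι)) f (hom β) (by
    rintro ⟨x, s⟩ hx
    have hs : 0 ≤ s := by simpa [f, hom_apply] using hx none (Finset.mem_univ _)
    have hg : ∀ i, 0 ≤ (g i).1 ⬝ᵥ x + (g i).2 * s := fun i => by
      simpa [f, hom_apply] using hx (some i) (Finset.mem_univ _)
    rw [hom_apply]
    dsimp only
    rcases hs.eq_or_lt with rfl | hs
    · simp only [mul_zero, add_zero] at hg ⊢
      by_contra hcon
      push Not at hcon
      -- For `s = 0` the vector `x` is a recession direction, and `β`, being nonnegative along the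
      -- whole ray from `x₀`, cannot have negative slope.
      have key : ∀ t : ℝ, 0 ≤ t → 0 ≤ affEval β x₀ + t * (β.1 ⬝ᵥ x) := fun t ht => by
        have : x₀ + t • x ∈ solSet g := fun i => by
          rw [affEval_add_arg, dotProduct_smul, smul_eq_mul]
          exact add_nonneg (hx₀ i) (mul_nonneg ht (hg i))
        simpa [affEval_add_arg] using hβ _ this
      have hβ₀ := hβ x₀ hx₀
      have h1 := key ((affEval β x₀ + 1) / -(β.1 ⬝ᵥ x)) (by
        apply div_nonneg <;> linarith)
      have h2 : (affEval β x₀ + 1) / -(β.1 ⬝ᵥ x) * (β.1 ⬝ᵥ x) = -(affEval β x₀ + 1) := by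
        field_simp [hcon.ne]
      linarith
    · have hmem : s⁻¹ • x ∈ solSet g := fun i => by
        have : affEval (g i) (s⁻¹ • x) = s⁻¹ * ((g i).1 ⬝ᵥ x + (g i).2 * s) := by
          simp only [affEval, dotProduct_smul, smul_eq_mul]; field_simp
        rw [this]
        exact mul_nonneg (inv_nonneg.2 hs.le) (hg i)
      have h1 := hβ _ hmem
      have : β.1 ⬝ᵥ x + β.2 * s = s * affEval β (s⁻¹ • x) := by
        simp only [affEval, dotProduct_smul, smul_eq_mul]; field_simp
      rw [this]
      exact mul_nonneg hs.le h1)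
  refine ⟨fun i => w (some i), w none, fun i => hw _, hw _, fun x => ?_⟩
  have := LinearMap.congr_fun e (x, 1)
  simp only [LinearMap.sum_apply, LinearMap.smul_apply, smul_eq_mul] at this
  simp only [Fintype.sum_option, f, Option.elim, hom_apply, mul_one, zero_dotProduct,
    zero_add] at this
  simp only [affEval, this]
  ring

/-! ### Certificates of nonnegativity -/

/-- The function `f` is bounded below on `ℝⁿ` by a combination `∑ᵢ αᵢ gᵢ`, where the multipliers
`αᵢ` are affine functions that are nonnegative on the solution set of the system `g`. -/
def Cert {ι : Type*} [Fintype ι] (g : ι → AffineFn n) (f : (Fin n → ℝ) → ℝ) : Prop :=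
  ∃ α : ι → AffineFn n, (∀ i, α i ∈ nonnegAffine (solSet g)) ∧
    ∀ x, ∑ i, affEval (α i) x * affEval (g i) x ≤ f x

section

variable {ι : Type*} [Fintype ι] {g : ι → AffineFn n} {f f' : (Fin n → ℝ) → ℝ}

theorem Cert.mono (h : Cert g f) (hf : ∀ x, f x ≤ f' x) : Cert g f' := by
  obtain ⟨α, h1, h2⟩ := h
  exact ⟨α, h1, fun x => (h2 x).trans (hf x)⟩

theorem Cert.congr (h : Cert g f) (hf : ∀ x, f x = f' x) : Cert g f' :=
  h.mono fun x => (hf x).le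

theorem Cert.nonneg (h : Cert g f) {x : Fin n → ℝ} (hx : x ∈ solSet g) : 0 ≤ f x := by
  obtain ⟨α, h1, h2⟩ := h
  exact (Finset.sum_nonneg fun i _ => mul_nonneg (h1 i x hx) (hx i)).trans (h2 x)

theorem cert_of_nonneg (hf : ∀ x, 0 ≤ f x) : Cert g f :=
  ⟨0, fun i x _ => by simp, fun x => by simpa using hf x⟩

theorem Cert.add (h : Cert g f) (h' : Cert g f') : Cert g (fun x => f x + f' x) := by
  obtain ⟨α, h1, h2⟩ := h
  obtain ⟨α', h1', h2'⟩ := h'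
  refine ⟨fun i => α i + α' i, fun i x hx => ?_, fun x => ?_⟩
  · rw [affEval_add]; exact add_nonneg (h1 i x hx) (h1' i x hx)
  · simp only [affEval_add, add_mul, Finset.sum_add_distrib]
    exact add_le_add (h2 x) (h2' x)

theorem Cert.const_mul (h : Cert g f) {r : ℝ} (hr : 0 ≤ r) : Cert g (fun x => r * f x) := by
  obtain ⟨α, h1, h2⟩ := h
  refine ⟨fun i => r • α i, fun i x hx => ?_, fun x => ?_⟩
  · rw [affEval_smul]; exact mul_nonneg hr (h1 i x hx)
  · simp only [affEval_smul, mul_assoc, ← Finset.mul_sum]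
    exact mul_le_mul_of_nonneg_left (h2 x) hr

theorem cert_sum {κ : Type*} (s : Finset κ) {F : κ → (Fin n → ℝ) → ℝ}
    (h : ∀ k ∈ s, Cert g (F k)) : Cert g (fun x => ∑ k ∈ s, F k x) := by
  classical
  induction s using Finset.induction_on with
  | empty => exact cert_of_nonneg fun x => by simp
  | insert a s ha ih =>
    simp only [Finset.sum_insert ha]
    exact (h a (Finset.mem_insert_self _ _)).add
      (ih fun k hk => h k (Finset.mem_insert_of_mem hk))

/-- With `γ = ∑ wᵢ gᵢ + w₀` and `β = ∑ vᵢ gᵢ + v₀` from Farkas, the multipliers `wᵢ β + w₀ vᵢ` leave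
only the constant `w₀ v₀ ≥ 0`. -/
theorem cert_mul (hne : (solSet g).Nonempty) {β γ : AffineFn n}
    (hβ : β ∈ nonnegAffine (solSet g)) (hγ : γ ∈ nonnegAffine (solSet g)) :
    Cert g (fun x => affEval β x * affEval γ x) := by
  obtain ⟨w, w₀, hw, hw₀, e⟩ := affine_farkas hne hγ
  obtain ⟨v, v₀, hv, hv₀, e'⟩ := affine_farkas hne hβ
  refine ⟨fun i => w i • β + (0, w₀ * v i), fun i x hx => ?_, fun x => ?_⟩
  · simp only [affEval_add, affEval_smul, affEval_const]
    exact add_nonneg (mul_nonneg (hw i) (hβ x hx)) (mul_nonneg hw₀ (hv i))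
  · simp only [affEval_add, affEval_smul, affEval_const]
    have : affEval β x * affEval γ x
        = ∑ i, (w i * affEval β x + w₀ * v i) * affEval (g i) x + w₀ * v₀ := by
      have h1 : ∑ i, (w i * affEval β x + w₀ * v i) * affEval (g i) x
          = affEval β x * ∑ i, w i * affEval (g i) x + w₀ * ∑ i, v i * affEval (g i) x := by
        rw [Finset.mul_sum, Finset.mul_sum, ← Finset.sum_add_distrib]
        exact Finset.sum_congr rfl fun i _ => by ring
      have h2 : ∑ i, w i * affEval (g i) x = affEval γ x - w₀ := by rw [e x]; ring
      have h3 : ∑ i, v i * affEval (g i) x = affEval β x - v₀ := by rw [e' x]; ring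
      rw [h1, h2, h3]; ring
    rw [this]
    linarith [mul_nonneg hw₀ hv₀]

theorem cert_affine (hne : (solSet g).Nonempty) {β : AffineFn n}
    (hβ : β ∈ nonnegAffine (solSet g)) : Cert g (affEval β) :=
  (cert_mul hne hβ (γ := (0, 1)) (fun x _ => by simp)).congr fun x => by simp

/-- Certificates are pulled back along affine maps. -/
theorem Cert.comp {κ : Type*} [Fintype κ] {k m : ℕ} {g : ι → AffineFn k} {f : (Fin k → ℝ) → ℝ}
    {g' : κ → AffineFn m} (h : Cert g f) (hne : (solSet g').Nonempty)
    {τ : (Fin m → ℝ) → Fin k → ℝ}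
    (hτ : ∀ α : AffineFn k, ∃ α' : AffineFn m, ∀ x, affEval α' x = affEval α (τ x))
    (hmaps : ∀ x ∈ solSet g', τ x ∈ solSet g) : Cert g' (fun x => f (τ x)) := by
  obtain ⟨α, h1, h2⟩ := h
  choose T hT using hτ
  refine (cert_sum Finset.univ fun i _ => cert_mul hne (β := T (α i)) (γ := T (g i))
    (fun x hx => ?_) (fun x hx => ?_)).mono fun x => ?_
  · rw [hT]; exact h1 i _ (hmaps x hx)
  · rw [hT]; exact hmaps x hx i
  · simp only [hT]; exact h2 _

/-- This is what compares the bound of a node with that of a box around it, although the two systems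
of inequalities are unrelated. -/
theorem Cert.mono_set {κ : Type*} [Fintype κ] {g' : κ → AffineFn n} (h : Cert g f)
    (hne : (solSet g').Nonempty) (hsub : solSet g' ⊆ solSet g) : Cert g' f :=
  h.comp hne (τ := id) (fun α => ⟨α, fun _ => rfl⟩) hsub

theorem exists_affEval_bound {S : Set (Fin n → ℝ)} (hS : Bornology.IsBounded S) (β : AffineFn n) :
    ∃ M : ℝ, 0 ≤ M ∧ ∀ x ∈ S, |affEval β x| ≤ M := by
  have hc : IsCompact (closure S) := hS.isCompact_closure
  obtain ⟨M, hM⟩ := hc.exists_bound_of_continuousOn (continuous_affEval β).continuousOn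
  exact ⟨max M 0, le_max_right _ _, fun x hx => (hM x (subset_closure hx)).trans (le_max_left _ _)⟩

/-- The sign of `β` does not matter: `β γ = (β + M) γ + M (-γ)`, where `M` bounds `|β|` and both `γ`
and `-γ` are nonnegative on the set. -/
theorem cert_mul_of_vanish (hne : (solSet g).Nonempty) (hb : Bornology.IsBounded (solSet g))
    (β : AffineFn n) {γ : AffineFn n} (hγ : ∀ x ∈ solSet g, affEval γ x = 0) :
    Cert g (fun x => affEval β x * affEval γ x) := by
  obtain ⟨M, hM, hβ⟩ := exists_affEval_bound hb β
  refine ((cert_mul hne (β := β + (0, M)) (γ := γ) (fun x hx => ?_) (fun x hx => ?_)).add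
    (cert_mul hne (β := (0, M)) (γ := -γ) (fun x hx => ?_) (fun x hx => ?_))).congr fun x => ?_
  · rw [affEval_add, affEval_const]; linarith [(abs_le.1 (hβ x hx)).1]
  · rw [hγ x hx]
  · simpa using hM
  · rw [affEval_neg, hγ x hx]; simp
  · simp only [affEval_add, affEval_const, affEval_neg]; ring

end

/-! ### Quadratic functions -/

/-- Quadratic functions: the sums of products of two affine functions. -/
def IsQuad (f : (Fin n → ℝ) → ℝ) : Prop :=
  f ∈ AddSubmonoid.closure {f | ∃ β γ : AffineFn n, f = fun x => affEval β x * affEval γ x}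

theorem IsQuad.add {f f' : (Fin n → ℝ) → ℝ} (h : IsQuad f) (h' : IsQuad f') :
    IsQuad (fun x => f x + f' x) := AddSubmonoid.add_mem _ h h'

theorem isQuad_mul (β γ : AffineFn n) : IsQuad (fun x => affEval β x * affEval γ x) :=
  AddSubmonoid.subset_closure ⟨β, γ, rfl⟩

theorem isQuad_affine (β : AffineFn n) : IsQuad (affEval β) := by
  convert isQuad_mul β (0, 1) using 2
  simp

theorem isQuad_const (r : ℝ) : IsQuad (fun _ : Fin n → ℝ => r) := by
  convert isQuad_affine ((0, r) : AffineFn n) using 2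
  simp

theorem isQuad_sum {κ : Type*} (s : Finset κ) {F : κ → (Fin n → ℝ) → ℝ}
    (h : ∀ k ∈ s, IsQuad (F k)) : IsQuad (fun x => ∑ k ∈ s, F k x) := by
  classical
  induction s using Finset.induction_on with
  | empty => simpa using isQuad_const 0
  | insert a s ha ih =>
    simp only [Finset.sum_insert ha]
    exact (h a (Finset.mem_insert_self _ _)).add
      (ih fun k hk => h k (Finset.mem_insert_of_mem hk))

theorem isQuad_quad (Q : Matrix (Fin n) (Fin n) ℝ) (c : Fin n → ℝ) : IsQuad (quad Q c) := by
  have h1 := isQuad_sum (Finset.univ : Finset (Fin n)) (F := fun i x =>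
    affEval (Pi.single i 1, 0) x * affEval (Q i, 0) x) fun i _ => isQuad_mul _ _
  have h2 := h1.add (isQuad_affine ((2 : ℝ) • (c, 0)))
  convert h2 using 2 with x
  simp [quad, affEval, dotProduct, Matrix.mulVec, Pi.single_apply, Finset.mul_sum, mul_assoc]

theorem IsQuad.induction {p : ((Fin n → ℝ) → ℝ) → Prop}
    (hmul : ∀ β γ : AffineFn n, p fun x => affEval β x * affEval γ x) (hzero : p fun _ => 0)
    (hadd : ∀ f f', p f → p f' → p fun x => f x + f' x) {f : (Fin n → ℝ) → ℝ} (hf : IsQuad f) :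
    p f := by
  unfold IsQuad at hf
  induction hf using AddSubmonoid.closure_induction with
  | mem f hf => obtain ⟨β, γ, rfl⟩ := hf; exact hmul β γ
  | zero => exact hzero
  | add f f' _ _ h h' => exact hadd f f' h h'

theorem IsQuad.continuous {f : (Fin n → ℝ) → ℝ} (hf : IsQuad f) : Continuous f :=
  hf.induction (p := fun f => Continuous f) (fun β γ => by fun_prop) (by fun_prop)
    (fun f f' h h' => by fun_prop)

section

variable {ι : Type*} [Fintype ι] {g : ι → AffineFn n}

/-- Makes the bounding problem feasible. For a product, `β γ + 3MM' = (β + M)(γ + M') + M'(M - β) +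
M(M' - γ)`. -/
theorem IsQuad.exists_cert {f : (Fin n → ℝ) → ℝ} (hf : IsQuad f) (hne : (solSet g).Nonempty)
    (hb : Bornology.IsBounded (solSet g)) : ∃ M : ℝ, Cert g (fun x => f x + M) := by
  refine hf.induction (p := fun f => ∃ M : ℝ, Cert g (fun x => f x + M)) (fun β γ => ?_)
    ⟨0, cert_of_nonneg fun x => by simp⟩ ?_
  · obtain ⟨M, hM, hβ⟩ := exists_affEval_bound hb β
    obtain ⟨M', hM', hγ⟩ := exists_affEval_bound hb γ
    refine ⟨3 * (M * M'), (((cert_mul hne (β := β + (0, M)) (γ := γ + (0, M'))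
      (fun x hx => ?_) (fun x hx => ?_)).add (cert_mul hne (β := (0, M')) (γ := (0, M) + -β)
      (fun x hx => ?_) (fun x hx => ?_))).add (cert_mul hne (β := (0, M)) (γ := (0, M') + -γ)
      (fun x hx => ?_) (fun x hx => ?_))).congr fun x => ?_⟩
    · rw [affEval_add, affEval_const]; linarith [(abs_le.1 (hβ x hx)).1]
    · rw [affEval_add, affEval_const]; linarith [(abs_le.1 (hγ x hx)).1]
    · simpa using hM'
    · rw [affEval_add, affEval_const, affEval_neg]; linarith [(abs_le.1 (hβ x hx)).2]
    · simpa using hM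
    · rw [affEval_add, affEval_const, affEval_neg]; linarith [(abs_le.1 (hγ x hx)).2]
    · simp only [affEval_add, affEval_const, affEval_neg]; ring
  · rintro f f' ⟨M, h⟩ ⟨M', h'⟩
    exact ⟨M + M', (h.add h').congr fun x => by ring⟩

/-- A quadratic function changes by a certified quantity when its argument is shifted by
multiples of affine functions that vanish on the solution set. -/
theorem IsQuad.cert_sub_comp {f : (Fin n → ℝ) → ℝ} (hf : IsQuad f) (hne : (solSet g).Nonempty)
    (hb : Bornology.IsBounded (solSet g)) {κ : Type*} [Fintype κ] (γ : κ → AffineFn n)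
    (hγ : ∀ k, ∀ x ∈ solSet g, affEval (γ k) x = 0) (z : κ → Fin n → ℝ) :
    Cert g (fun x => f x - f (x + ∑ k, affEval (γ k) x • z k)) := by
  refine hf.induction (p := fun f => Cert g (fun x => f x - f (x + ∑ k, affEval (γ k) x • z k)))
    (fun α β => ?_) (cert_of_nonneg fun x => by simp) ?_
  · have key : ∀ (α : AffineFn n) x, affEval α (x + ∑ k, affEval (γ k) x • z k)
        = affEval α x + affEval (∑ k, (α.1 ⬝ᵥ z k) • γ k) x := fun α x => by
      rw [affEval_add_arg, affEval_sum, dotProduct_sum]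
      simp only [affEval_smul, dotProduct_smul, smul_eq_mul]
      congr 1
      exact Finset.sum_congr rfl fun k _ => mul_comm _ _
    have hv : ∀ (α : AffineFn n), ∀ x ∈ solSet g,
        affEval (-∑ k, (α.1 ⬝ᵥ z k) • γ k) x = 0 := fun α x hx => by
      rw [affEval_neg, affEval_sum]
      simp [hγ _ x hx]
    -- If the shift changes `α`, `β` by `α'`, `β'`, then `αβ - (α + α')(β + β') = α(-β') + (β +
    -- β')(-α')`, and `α'`, `β'` vanish on the set.
    refine ((cert_mul_of_vanish hne hb α (hv β)).add (cert_mul_of_vanish hne hb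
      (β + ∑ k, (β.1 ⬝ᵥ z k) • γ k) (hv α))).congr fun x => ?_
    simp only [key, affEval_neg, affEval_add]
    ring
  · intro f f' h h'
    exact (h.add h').congr fun x => by ring

end

end

section

/-! ### The bounding problem attains its maximum -/

variable {n : ℕ} {ι : Type*} [Fintype ι] {g : ι → AffineFn n}

theorem affEval_midpoint (α : AffineFn n) (x y : Fin n → ℝ) :
    affEval α ((1 / 2 : ℝ) • (x + y)) = (1 / 2) * (affEval α x + affEval α y) := by
  simp only [affEval, dotProduct_smul, dotProduct_add, smul_eq_mul]; ring

/-- Averaging with a point where one more inequality is strict keeps all earlier strict ones strict.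
-/
theorem exists_relInterior_point {ι : Type*} [Finite ι] {g : ι → AffineFn n} (hne : (solSet g).Nonempty) :
    ∃ x₀ ∈ solSet g, ∀ i, (∃ y ∈ solSet g, affEval (g i) y ≠ 0) → 0 < affEval (g i) x₀ := by
  classical
  have := Fintype.ofFinite ι
  have key : ∀ s : Finset ι, ∃ x₀ ∈ solSet g, ∀ i ∈ s,
      (∃ y ∈ solSet g, affEval (g i) y ≠ 0) → 0 < affEval (g i) x₀ := by
    intro s
    induction s using Finset.induction_on with
    | empty => exact ⟨hne.some, hne.some_mem, by simp⟩
    | insert a s ha ih =>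
      obtain ⟨x, hx, h⟩ := ih
      by_cases hy : ∃ y ∈ solSet g, affEval (g a) y ≠ 0
      · obtain ⟨y, hy, hya⟩ := hy
        refine ⟨(1 / 2 : ℝ) • (x + y), fun i => ?_, fun i hi hi' => ?_⟩
        · rw [affEval_midpoint]; linarith [hx i, hy i]
        · rw [affEval_midpoint]
          rcases Finset.mem_insert.1 hi with rfl | hi
          · linarith [hx i, (hy i).lt_of_ne' hya]
          · linarith [h i hi hi', hy i]
      · refine ⟨x, hx, fun i hi hi' => ?_⟩
        rcases Finset.mem_insert.1 hi with rfl | hi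
        · exact absurd hi' hy
        · exact h i hi hi'
  obtain ⟨x, hx, h⟩ := key Finset.univ
  exact ⟨x, hx, fun i => h i (Finset.mem_univ _)⟩

theorem exists_generalizedInverse {V W : Type*} [AddCommGroup V] [Module ℝ V] [AddCommGroup W]
    [Module ℝ W] (L : V →ₗ[ℝ] W) : ∃ Z : W →ₗ[ℝ] V, ∀ x, L (Z (L x)) = L x := by
  obtain ⟨Z₀, hZ₀⟩ := L.rangeRestrict.exists_rightInverse_of_surjective L.range_rangeRestrict
  obtain ⟨Z, hZ⟩ := LinearMap.exists_extend Z₀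
  refine ⟨Z, fun x => ?_⟩
  have h1 : Z (L x) = Z₀ (L.rangeRestrict x) := LinearMap.congr_fun hZ (L.rangeRestrict x)
  rw [h1]
  exact congrArg Subtype.val (LinearMap.congr_fun hZ₀ (L.rangeRestrict x))

/-- An affine projection onto the zero set of finitely many affine functions. -/
theorem exists_projection (γ : ι → AffineFn n) {x₀ : Fin n → ℝ} (h₀ : ∀ k, affEval (γ k) x₀ = 0) :
    ∃ z : ι → Fin n → ℝ, ∀ x k, affEval (γ k) (x + ∑ k, affEval (γ k) x • z k) = 0 := by
  classical
  let L : (Fin n → ℝ) →ₗ[ℝ] (ι → ℝ) :=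
    { toFun := fun x k => (γ k).1 ⬝ᵥ x
      map_add' := fun x y => by ext k; simp [dotProduct_add]
      map_smul' := fun r x => by ext k; simp }
  obtain ⟨Z, hZ⟩ := exists_generalizedInverse L
  refine ⟨fun k => -Z (Pi.single k 1), fun x k => ?_⟩
  have hγ : ∀ x k, affEval (γ k) x = L (x - x₀) k := fun x k => by
    have := affEval_add_arg (γ k) x₀ (x - x₀)
    rw [h₀, add_sub_cancel, zero_add] at this
    exact this
  have hsum : ∑ k, affEval (γ k) x • -Z (Pi.single k 1) = -Z (L (x - x₀)) := by
    conv_rhs => rw [pi_eq_sum_univ' (L (x - x₀)), map_sum]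
    rw [← Finset.sum_neg_distrib]
    refine Finset.sum_congr rfl fun k _ => ?_
    rw [map_smul, smul_neg, hγ]
  rw [hsum, hγ]
  have : x + -Z (L (x - x₀)) - x₀ = (x - x₀) - Z (L (x - x₀)) := by abel
  rw [this, map_sub, hZ, sub_self]
  rfl

/-- A value at most `Cᵢ` at `x₀` together with nonnegativity at `x₀ ± t eⱼ` bounds each slope by `Cᵢ
/ t`; the constant term is then bounded as well. -/
theorem isCompact_multipliers {ι : Type*} (x₀ : Fin n → ℝ) {t : ℝ} (ht : 0 < t) (C : ι → ℝ)
    {F : Set (ι → AffineFn n)} (hF : IsClosed F) (hC : ∀ α ∈ F, ∀ i, 0 ≤ affEval (α i) x₀ ∧ affEval (α i) x₀ ≤ C i)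
    (hpos : ∀ α ∈ F, ∀ i j, 0 ≤ affEval (α i) (x₀ + t • Pi.single j 1) ∧
      0 ≤ affEval (α i) (x₀ - t • Pi.single j 1)) : IsCompact F := by
  let D : ι → ℝ := fun i => C i / t
  have hbound : ∀ α ∈ F, ∀ i j, |(α i).1 j| ≤ D i := fun α hα i j => by
    have h1 := (hpos α hα i j).1
    have h2 := (hpos α hα i j).2
    rw [sub_eq_add_neg, ← smul_neg, affEval_add_arg] at h2
    rw [affEval_add_arg] at h1
    simp only [dotProduct_smul, dotProduct_neg, dotProduct_single, mul_one, smul_eq_mul] at h1 h2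
    have h3 := (hC α hα i).2
    rw [abs_le]
    simp only [D]
    constructor
    · rw [← neg_div, div_le_iff₀ ht]; linarith
    · rw [le_div_iff₀ ht]; linarith
  let D' : ι → ℝ := fun i => |C i| + ∑ j, D i * |x₀ j|
  have hD' : ∀ α ∈ F, ∀ i, |(α i).2| ≤ D' i := fun α hα i => by
    have h1 : |affEval (α i) x₀| ≤ |C i| := by
      rw [abs_of_nonneg (hC α hα i).1]; exact (hC α hα i).2.trans (le_abs_self _)
    have h2 : |(α i).1 ⬝ᵥ x₀| ≤ ∑ j, D i * |x₀ j| := by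
      refine (Finset.abs_sum_le_sum_abs _ _).trans (Finset.sum_le_sum fun j _ => ?_)
      rw [abs_mul]
      exact mul_le_mul_of_nonneg_right (hbound α hα i j) (abs_nonneg _)
    have h3 : (α i).2 = affEval (α i) x₀ - (α i).1 ⬝ᵥ x₀ := by simp [affEval]
    rw [h3]
    exact (abs_sub _ _).trans (add_le_add h1 h2)
  refine IsCompact.of_isClosed_subset (isCompact_univ_pi fun i =>
    (isCompact_Icc (a := fun _ : Fin n => -D i) (b := fun _ => D i)).prod
      (isCompact_Icc (a := -D' i) (b := D' i))) hF fun α hα i _ => ?_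
  exact ⟨⟨fun j => (abs_le.1 (hbound α hα i j)).1, fun j => (abs_le.1 (hbound α hα i j)).2⟩,
    abs_le.1 (hD' α hα i)⟩

/-- `J` singles out the inequalities that are not implicit equalities; the others, collected in `γ`,
cut out the affine hull, with projection `π`. On the hull the multipliers outside `J` contribute
nothing and can be set to zero, and those in `J` can be replaced by their compositions with `π`. At
the relative interior point `x₀` the constraints in `J` are positive, which bounds the multipliers,
so `ℓ` is maximized over a compact set. -/
theorem IsQuad.exists_isGreatest_cert {f : (Fin n → ℝ) → ℝ} (hf : IsQuad f)
    (hne : (solSet g).Nonempty) (hb : Bornology.IsBounded (solSet g)) :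
    ∃ l, IsGreatest {l : ℝ | Cert g (fun x => f x - l)} l := by
  classical
  obtain ⟨x₀, hx₀, hrel⟩ := exists_relInterior_point hne
  let J : ι → Prop := fun i => ∃ y ∈ solSet g, affEval (g i) y ≠ 0
  let γ : ι → AffineFn n := fun i => if J i then 0 else g i
  have hγJ : ∀ i, J i → γ i = 0 := fun i hi => if_pos hi
  have hγ' : ∀ i, ¬ J i → γ i = g i := fun i hi => if_neg hi
  have hγ : ∀ i, ∀ x ∈ solSet g, affEval (γ i) x = 0 := fun i x hx => by
    by_cases hi : J i
    · rw [hγJ i hi, affEval_zero]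
    · rw [hγ' i hi]
      by_contra hcon
      exact hi ⟨x, hx, hcon⟩
  obtain ⟨z, hz⟩ := exists_projection γ fun k => hγ k x₀ hx₀
  let π : (Fin n → ℝ) → Fin n → ℝ := fun x => x + ∑ k, affEval (γ k) x • z k
  have hπ_def : ∀ x, π x = x + ∑ k, affEval (γ k) x • z k := fun _ => rfl
  have hπ_cont : Continuous π := by
    refine continuous_id.add (continuous_finsetSum _ fun k _ => ?_)
    exact (continuous_affEval _).smul continuous_const
  have hπ_fix : ∀ x, (∀ k, affEval (γ k) x = 0) → π x = x := fun x hx => by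
    rw [hπ_def]; simp [hx]
  have hπ_vanish : ∀ x k, affEval (γ k) (π x) = 0 := hz
  let T : AffineFn n → AffineFn n := fun α => α + ∑ k, (α.1 ⬝ᵥ z k) • γ k
  have hT : ∀ α x, affEval (T α) x = affEval α (π x) := fun α x => by
    simp only [T, hπ_def, affEval_add_arg, affEval_add, affEval_sum, affEval_smul, dotProduct_sum,
      dotProduct_smul, smul_eq_mul]
    congr 1
    exact Finset.sum_congr rfl fun k _ => mul_comm _ _
  -- For small `t` the points `π (x₀ ± t eⱼ)` stay in the feasible set, so a multiplier composed
  -- with `π` is nonnegative at `x₀ ± t eⱼ` even when these points leave the affine hull.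
  obtain ⟨t, ht, htpos⟩ : ∃ t : ℝ, 0 < t ∧ ∀ i j, J i →
      0 < affEval (g i) (π (x₀ + t • Pi.single j 1)) ∧
      0 < affEval (g i) (π (x₀ - t • Pi.single j 1)) := by
    have hev : ∀ᶠ t : ℝ in 𝓝 0, ∀ i j, J i →
        0 < affEval (g i) (π (x₀ + t • Pi.single j 1)) ∧
        0 < affEval (g i) (π (x₀ - t • Pi.single j 1)) := by
      refine Filter.eventually_all.2 fun i => Filter.eventually_all.2 fun j => ?_
      by_cases hi : J i
      · have hp : 0 < affEval (g i) (π x₀) := by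
          rw [hπ_fix x₀ fun k => hγ k x₀ hx₀]; exact hrel i hi
        have h1 : ContinuousAt (fun t : ℝ => affEval (g i) (π (x₀ + t • Pi.single j 1))) 0 :=
          Continuous.continuousAt (by fun_prop)
        have h2 : ContinuousAt (fun t : ℝ => affEval (g i) (π (x₀ - t • Pi.single j 1))) 0 :=
          Continuous.continuousAt (by fun_prop)
        filter_upwards [h1.eventually_const_lt (by simpa using hp),
          h2.eventually_const_lt (by simpa using hp)] with t h1 h2 _ using ⟨h1, h2⟩
      · exact Filter.Eventually.of_forall fun t h => absurd h hi
    obtain ⟨t, h, ht⟩ := ((hev.filter_mono nhdsWithin_le_nhds).and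
      (self_mem_nhdsWithin (s := Ioi (0 : ℝ)))).exists
    exact ⟨t, ht, h⟩
  have hmem : ∀ x, (∀ i, J i → 0 < affEval (g i) (π x)) → π x ∈ solSet g := fun x hx i => by
    by_cases hi : J i
    · exact (hx i hi).le
    · rw [← hγ' i hi, hπ_vanish]
  obtain ⟨M, hM⟩ := hf.exists_cert hne hb
  have hl₁ : Cert g (fun x => f x - -M) := hM.congr fun x => by ring
  set l₁ := -M
  have hl_le : ∀ l, Cert g (fun x => f x - l) → l ≤ f x₀ := fun l hl => by
    linarith [hl.nonneg hx₀]
  let F : Set (ι → AffineFn n) := {α | (∀ i, ∀ x ∈ solSet g, 0 ≤ affEval (α i) x) ∧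
    (∀ i, ¬ J i → α i = 0) ∧
    (∀ i, affEval (α i) x₀ * affEval (g i) x₀ ≤ f x₀ - l₁) ∧
    ∀ i j, 0 ≤ affEval (α i) (x₀ + t • Pi.single j 1) ∧
      0 ≤ affEval (α i) (x₀ - t • Pi.single j 1)}
  have hcont : ∀ (i : ι) (x : Fin n → ℝ), Continuous fun α : ι → AffineFn n => affEval (α i) x :=
    fun i x => by unfold affEval; fun_prop
  have hFclosed : IsClosed F := by
    refine IsClosed.and ?_ (IsClosed.and ?_ (IsClosed.and ?_ ?_))
    · simp only [Set.ofPred_forall]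
      exact isClosed_iInter fun i => isClosed_iInter fun x => isClosed_iInter fun _ =>
        isClosed_le continuous_const (hcont i x)
    · simp only [Set.ofPred_forall]
      exact isClosed_iInter fun i => isClosed_iInter fun _ =>
        isClosed_eq (continuous_apply i) continuous_const
    · simp only [Set.ofPred_forall]
      exact isClosed_iInter fun i => isClosed_le ((hcont i x₀).mul continuous_const)
        continuous_const
    · simp only [Set.ofPred_forall]
      exact isClosed_iInter fun i => isClosed_iInter fun j =>
        (isClosed_le continuous_const (hcont i _)).inter
          (isClosed_le continuous_const (hcont i _))
  have hFcompact : IsCompact F := by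
    refine isCompact_multipliers x₀ ht (fun i => (f x₀ - l₁) / affEval (g i) x₀) hFclosed
      (fun α hα i => ⟨hα.1 i x₀ hx₀, ?_⟩) fun α hα i j => hα.2.2.2 i j
    by_cases hi : J i
    · rw [le_div_iff₀ (hrel i hi)]; exact hα.2.2.1 i
    · rw [hα.2.1 i hi, affEval_zero]
      exact div_nonneg (by linarith [hl_le _ hl₁]) (hx₀ i)
  -- The relaxed problem: the inequality is demanded only on the affine hull.
  let G : Set (ℝ × (ι → AffineFn n)) := (Icc l₁ (f x₀) ×ˢ F) ∩
    {p | ∀ x, (∀ k, affEval (γ k) x = 0) → ∑ i, affEval (p.2 i) x * affEval (g i) x ≤ f x - p.1}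
  have hGcompact : IsCompact G := by
    refine (isCompact_Icc.prod hFcompact).inter_right ?_
    simp only [Set.ofPred_forall]
    refine isClosed_iInter fun x => isClosed_iInter fun _ => isClosed_le
      (continuous_finsetSum _ fun i _ => ?_) (by fun_prop)
    exact ((hcont i x).comp continuous_snd).mul continuous_const
  have hG_of : ∀ l, l₁ ≤ l → Cert g (fun x => f x - l) → ∃ α, (l, α) ∈ G := by
    rintro l hl₁l hl
    have hlx := hl_le l hl
    obtain ⟨α, hα, hαf⟩ := hl
    have hfix : ∀ x ∈ solSet g, π x = x := fun x hx => hπ_fix x fun k => hγ k x hx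
    have hsum : ∀ x, (∀ k, affEval (γ k) x = 0) →
        ∑ i, affEval (if J i then T (α i) else 0) x * affEval (g i) x ≤ f x - l := fun x hx => by
      refine le_trans (le_of_eq (Finset.sum_congr rfl fun i _ => ?_)) (hαf x)
      by_cases hi : J i
      · rw [if_pos hi, hT, hπ_fix x hx]
      · have h0 : affEval (g i) x = 0 := by rw [← hγ' i hi]; exact hx i
        rw [h0, mul_zero, mul_zero]
    have hnn : ∀ i, ∀ x ∈ solSet g, 0 ≤ affEval (if J i then T (α i) else 0) x := fun i x hx => by
      by_cases hi : J i
      · rw [if_pos hi, hT, hfix x hx]; exact hα i x hx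
      · rw [if_neg hi, affEval_zero]
    refine ⟨fun i => if J i then T (α i) else 0, ⟨⟨hl₁l, hlx⟩, hnn, fun i hi => if_neg hi,
      fun i => ?_, fun i j => ?_⟩, hsum⟩
    · have h1 := hsum x₀ fun k => hγ k x₀ hx₀
      have h2 := Finset.single_le_sum (f := fun i =>
        affEval (if J i then T (α i) else 0) x₀ * affEval (g i) x₀)
        (fun i _ => mul_nonneg (hnn i x₀ hx₀) (hx₀ i)) (Finset.mem_univ i)
      linarith
    · by_cases hi : J i
      · simp only [if_pos hi, hT]
        exact ⟨hα i _ (hmem _ fun i hi => (htpos i j hi).1),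
          hα i _ (hmem _ fun i hi => (htpos i j hi).2)⟩
      · simp [hi]
  obtain ⟨α₁, hα₁⟩ := hG_of l₁ le_rfl hl₁
  obtain ⟨⟨l, α⟩, hG, hmax⟩ := hGcompact.exists_isMaxOn ⟨_, hα₁⟩ continuous_fst.continuousOn
  refine ⟨l, ?_, fun l' hl' => ?_⟩
  · obtain ⟨⟨hl, hF⟩, hV⟩ := hG
    -- Lifting from the hull to `ℝⁿ`: the residual `r` is nonnegative after composition with `π`,
    -- and `r - r ∘ π` is certified by `IsQuad.cert_sub_comp`.
    have hr : IsQuad fun x => (f x + -l) + ∑ i, affEval (-α i) x * affEval (g i) x :=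
      (hf.add (isQuad_const _)).add (isQuad_sum _ fun i _ => isQuad_mul _ _)
    have h1 : Cert g (fun x => (f (π x) + -l) + ∑ i, affEval (-α i) (π x) * affEval (g i) (π x)) :=
      cert_of_nonneg fun x => by
        have := hV (π x) (hπ_vanish x)
        dsimp only at this
        simp only [affEval_neg, neg_mul, Finset.sum_neg_distrib]
        linarith
    have h2 := hr.cert_sub_comp hne hb γ hγ z
    have h3 : Cert g (fun x => ∑ i, affEval (α i) x * affEval (g i) x) :=
      ⟨α, hF.1, fun x => le_rfl⟩
    refine ((h1.add h2).add h3).congr fun x => ?_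
    simp only [← hπ_def, affEval_neg, neg_mul, Finset.sum_neg_distrib]
    ring
  · rcases le_total l₁ l' with h | h
    · obtain ⟨α', hα'⟩ := hG_of l' h hl'
      exact hmax hα'
    · exact h.trans hG.1.1.1

end

section

variable {n : ℕ}

/-! ### Polyhedra and boxes as solution sets -/

/-- The system `A x ≤ b` as a family of affine functions. -/
def polyFam {m : ℕ} (A : Matrix (Fin m) (Fin n) ℝ) (b : Fin m → ℝ) (i : Fin m) : AffineFn n :=
  (-A i, b i)

theorem affEval_polyFam {m : ℕ} (A : Matrix (Fin m) (Fin n) ℝ) (b : Fin m → ℝ) (i : Fin m)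
    (x : Fin n → ℝ) : affEval (polyFam A b i) x = b i - (A.mulVec x) i := by
  simp [affEval, polyFam, Matrix.mulVec]; ring

theorem solSet_polyFam {m : ℕ} (A : Matrix (Fin m) (Fin n) ℝ) (b : Fin m → ℝ) :
    solSet (polyFam A b) = polyhedron A b := by
  ext x; simp [solSet, polyhedron, affEval_polyFam]

theorem sum_polyFam {m : ℕ} (A : Matrix (Fin m) (Fin n) ℝ) (b : Fin m → ℝ)
    (Q : Matrix (Fin n) (Fin n) ℝ) (c : Fin n → ℝ) (α : Fin m → AffineFn n) (x : Fin n → ℝ) :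
    penalized A b Q c α x = quad Q c x - ∑ i, affEval (α i) x * affEval (polyFam A b i) x := by
  rw [penalized, sub_eq_add_neg, ← Finset.sum_neg_distrib]
  congr 1
  refine Finset.sum_congr rfl fun i _ => ?_
  rw [affEval_polyFam]; ring

theorem boundFeasible_iff {m : ℕ} {A : Matrix (Fin m) (Fin n) ℝ} {b : Fin m → ℝ}
    {Q : Matrix (Fin n) (Fin n) ℝ} {c : Fin n → ℝ} {l : ℝ} :
    (∃ α, BoundFeasible A b Q c l α) ↔ Cert (polyFam A b) (fun x => quad Q c x - l) := by
  simp only [BoundFeasible, Cert, solSet_polyFam, sum_polyFam]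
  refine exists_congr fun α => and_congr_right fun _ => forall_congr' fun x => ?_
  constructor <;> intro h <;> linarith

/-- The inequalities that define the box `X(y, d)`. -/
def boxFam (y d : Fin n → ℝ) : Fin n ⊕ Fin n → AffineFn n
  | .inl i => (-Pi.single i 1, y i + d i)
  | .inr i => (Pi.single i 1, d i - y i)

@[simp] theorem affEval_boxFam_inl (y d : Fin n → ℝ) (i : Fin n) (x : Fin n → ℝ) :
    affEval (boxFam y d (.inl i)) x = y i + d i - x i := by
  simp [affEval, boxFam]; ring

@[simp] theorem affEval_boxFam_inr (y d : Fin n → ℝ) (i : Fin n) (x : Fin n → ℝ) :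
    affEval (boxFam y d (.inr i)) x = x i - y i + d i := by
  simp [affEval, boxFam]; ring

theorem mem_box {y d x : Fin n → ℝ} : x ∈ box y d ↔ ∀ i, y i - d i ≤ x i ∧ x i ≤ y i + d i := by
  simp [box, Pi.le_def, forall_and]

theorem solSet_boxFam (y d : Fin n → ℝ) : solSet (boxFam y d) = box y d := by
  ext x
  simp only [solSet, mem_ofPred_eq, mem_box, Sum.forall, affEval_boxFam_inl, affEval_boxFam_inr,
    ← forall_and]
  exact forall_congr' fun i => ⟨fun h => ⟨by linarith, by linarith⟩,
    fun h => ⟨by linarith, by linarith⟩⟩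

theorem self_mem_box {y d : Fin n → ℝ} (hd : 0 ≤ d) : y ∈ box y d :=
  mem_box.2 fun i => ⟨by linarith [show 0 ≤ d i from hd i], by linarith [show 0 ≤ d i from hd i]⟩

theorem isBounded_box (y d : Fin n → ℝ) : Bornology.IsBounded (box y d) :=
  Metric.isBounded_Icc _ _

theorem mem_boxFeasible_iff {Q : Matrix (Fin n) (Fin n) ℝ} {c y d : Fin n → ℝ} {l : ℝ} :
    l ∈ boxFeasible Q c y d ↔ Cert (boxFam y d) (fun x => quad Q c x - l) := by
  have key : ∀ (α μ : Fin n → AffineFn n) x,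
      ∑ i, (affEval (α i) x * (x i - y i - d i) + affEval (μ i) x * (-x i + y i - d i))
      = -∑ s : Fin n ⊕ Fin n, affEval (Sum.elim α μ s) x * affEval (boxFam y d s) x :=
    fun α μ x => by
      rw [Fintype.sum_sum_type, ← Finset.sum_add_distrib, ← Finset.sum_neg_distrib]
      refine Finset.sum_congr rfl fun i _ => ?_
      simp; ring
  constructor
  · rintro ⟨α, μ, hα, hμ, h⟩
    refine ⟨Sum.elim α μ, ?_, fun x => ?_⟩
    · rw [solSet_boxFam]; rintro (i | i)
      · exact hα i
      · exact hμ i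
    · have := h x
      rw [key] at this
      linarith
  · rintro ⟨α, hα, h⟩
    rw [solSet_boxFam] at hα
    refine ⟨fun i => α (.inl i), fun i => α (.inr i), fun i => hα _, fun i => hα _, fun x => ?_⟩
    rw [key]
    have h1 : Sum.elim (fun i => α (.inl i)) (fun i => α (.inr i)) = α := by
      ext s : 1; cases s <;> rfl
    rw [h1]
    linarith [h x]

/-! ### The box bound -/

theorem Phi_isGreatest (Q : Matrix (Fin n) (Fin n) ℝ) (c y : Fin n → ℝ) {d : Fin n → ℝ}
    (hd : 0 ≤ d) : IsGreatest (boxFeasible Q c y d) (Phi Q c y d) := by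
  obtain ⟨l, hl⟩ := (isQuad_quad Q c).exists_isGreatest_cert (g := boxFam y d)
    (by rw [solSet_boxFam]; exact ⟨y, self_mem_box hd⟩)
    (by rw [solSet_boxFam]; exact isBounded_box y d)
  have : boxFeasible Q c y d = {l | Cert (boxFam y d) (fun x => quad Q c x - l)} := by
    ext l; exact mem_boxFeasible_iff
  rw [← this] at hl
  rwa [Phi, hl.csSup_eq]

/-- The coordinate shift `x ↦ y + D z`. -/
theorem exists_affine_comp_scale (y d : Fin n → ℝ) (α : AffineFn n) :
    ∃ α' : AffineFn n, ∀ z, affEval α' z = affEval α (y + d * z) := by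
  refine ⟨(α.1 * d, affEval α y), fun z => ?_⟩
  rw [affEval_add_arg]
  simp [affEval, dotProduct, mul_assoc]; ring

/-- The bound over a box, possibly degenerate, is the bound over a cube after scaling. -/
theorem cert_box_iff {y d : Fin n → ℝ} (hd : 0 ≤ d) {f : (Fin n → ℝ) → ℝ} (hf : IsQuad f) :
    Cert (boxFam y d) f ↔ Cert (boxFam (0 : Fin n → ℝ) 1) (fun z => f (y + d * z)) := by
  have hne : (solSet (boxFam y d)).Nonempty := by
    rw [solSet_boxFam]; exact ⟨y, self_mem_box hd⟩
  have hne' : (solSet (boxFam (0 : Fin n → ℝ) 1)).Nonempty := by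
    rw [solSet_boxFam]; exact ⟨0, self_mem_box zero_le_one⟩
  constructor
  · intro h
    refine h.comp hne' (exists_affine_comp_scale y d) fun z hz => ?_
    rw [solSet_boxFam, mem_box] at hz ⊢
    intro i
    have h1 := hz i
    have h2 : 0 ≤ d i := hd i
    simp only [Pi.zero_apply, Pi.one_apply, Pi.add_apply, Pi.mul_apply] at h1 ⊢
    constructor <;> nlinarith
  · intro h
    -- The inverse scaling uses `0⁻¹ = 0`: in coordinates with `d i = 0` the composite map resets `x
    -- i` to `y i`. The difference `x i - y i` vanishes on the box, so `IsQuad.cert_sub_comp`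
    -- repairs the reset.
    have h1 : Cert (boxFam y d) (fun x => f (y + d * (-(d⁻¹ * y) + d⁻¹ * x))) := by
      refine h.comp hne (exists_affine_comp_scale _ _) fun x hx => ?_
      rw [solSet_boxFam, mem_box] at hx ⊢
      intro i
      have h1 := hx i
      have h2 : 0 ≤ d i := hd i
      simp only [Pi.zero_apply, Pi.one_apply, Pi.add_apply, Pi.mul_apply, Pi.neg_apply,
        Pi.inv_apply]
      rcases h2.eq_or_lt with h0 | h0
      · simp [← h0]
      · have h3 : -((d i)⁻¹ * y i) + (d i)⁻¹ * x i = (x i - y i) / d i := by field_simp; ring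
        rw [h3, le_div_iff₀ h0, div_le_iff₀ h0]
        constructor <;> linarith
    have h2 := hf.cert_sub_comp hne (by rw [solSet_boxFam]; exact isBounded_box y d)
      (fun i : Fin n => if d i = 0 then ((Pi.single i 1, -y i) : AffineFn n) else 0)
      (fun i x hx => by
        split_ifs with h0
        · rw [solSet_boxFam, mem_box] at hx
          have := hx i
          rw [h0] at this
          simp [affEval]; linarith
        · simp) (fun i => -Pi.single i 1)
    refine (h1.add h2).congr fun x => ?_
    have : y + d * (-(d⁻¹ * y) + d⁻¹ * x) = x + ∑ i, affEval (if d i = 0 then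
        ((Pi.single i 1, -y i) : AffineFn n) else 0) x • (-Pi.single i 1 : Fin n → ℝ) := by
      ext j
      simp only [Pi.add_apply, Pi.mul_apply, Pi.neg_apply, Pi.inv_apply, Finset.sum_apply,
        Pi.smul_apply, smul_eq_mul]
      rw [Finset.sum_eq_single j]
      · by_cases h0 : d j = 0
        · simp [h0, affEval]
        · simp [h0]; field_simp; ring
      · intro i _ hij
        simp [hij.symm]
      · simp
    rw [this]; ring

/-- Exhibits the coefficients on the cube, which depend continuously on `(y, d)` even where some `d
i` vanish. -/
theorem quad_scale (Q : Matrix (Fin n) (Fin n) ℝ) (c y d z : Fin n → ℝ) :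
    quad Q c (y + d * z) = quad Q c y
      + ∑ i, (d i * ((Q.mulVec y) i + (Q.transpose.mulVec y) i + 2 * c i)) * z i
      + ∑ i, ∑ j, (d i * Q i j * d j) * (z i * z j) := by
  have h1 : (d * z) ⬝ᵥ Q.mulVec (d * z) = ∑ i, ∑ j, (d i * Q i j * d j) * (z i * z j) := by
    simp only [dotProduct, Matrix.mulVec, Finset.mul_sum, Pi.mul_apply]
    exact Finset.sum_congr rfl fun i _ => Finset.sum_congr rfl fun j _ => by ring
  have h2 : y ⬝ᵥ Q.mulVec (d * z) = (Q.transpose.mulVec y) ⬝ᵥ (d * z) := by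
    rw [Matrix.dotProduct_mulVec, Matrix.mulVec_transpose]
  have h3 : ∑ i, (d i * ((Q.mulVec y) i + (Q.transpose.mulVec y) i + 2 * c i)) * z i
      = (d * z) ⬝ᵥ Q.mulVec y + (Q.transpose.mulVec y) ⬝ᵥ (d * z) + 2 * (c ⬝ᵥ (d * z)) := by
    simp only [dotProduct, Finset.mul_sum, Pi.mul_apply, ← Finset.sum_add_distrib]
    exact Finset.sum_congr rfl fun i _ => by ring
  rw [h3, ← h1, ← h2]
  simp only [quad, Matrix.mulVec_add, dotProduct_add, add_dotProduct]
  ring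

/-- Each monomial is treated separately; for the mixed ones, `2(1 ± zᵢzⱼ) = (1 + zᵢ)(1 ± zⱼ) + (1 -
zᵢ)(1 ∓ zⱼ)`. -/
theorem cert_cube_quadratic (e₀ : ℝ) (e₁ : Fin n → ℝ) (e₂ : Fin n → Fin n → ℝ) :
    Cert (boxFam (0 : Fin n → ℝ) 1) (fun z => (e₀ + ∑ i, e₁ i * z i
      + ∑ i, ∑ j, e₂ i j * (z i * z j)) + (|e₀| + ∑ i, |e₁ i| + ∑ i, ∑ j, |e₂ i j|)) := by
  have hne' : (solSet (boxFam (0 : Fin n → ℝ) 1)).Nonempty := by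
    rw [solSet_boxFam]; exact ⟨0, self_mem_box zero_le_one⟩
  have hg : ∀ s, boxFam (0 : Fin n → ℝ) 1 s ∈ nonnegAffine (solSet (boxFam (0 : Fin n → ℝ) 1)) :=
    fun s x hx => hx s
  have hlin : ∀ (e : ℝ) (i : Fin n), Cert (boxFam (0 : Fin n → ℝ) 1)
      (fun z => e * z i + |e|) := fun e i => by
    rcases abs_cases e with ⟨h, h'⟩ | ⟨h, h'⟩ <;> rw [h]
    · refine ((cert_affine hne' (hg (.inr i))).const_mul h').congr fun z => ?_
      simp; ring
    · refine ((cert_affine hne' (hg (.inl i))).const_mul (neg_nonneg.2 h'.le)).congr fun z => ?_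
      simp; ring
  have hquad : ∀ (e : ℝ) (i j : Fin n), Cert (boxFam (0 : Fin n → ℝ) 1)
      (fun z => e * (z i * z j) + |e|) := fun e i j => by
    rcases abs_cases e with ⟨h, h'⟩ | ⟨h, h'⟩ <;> rw [h]
    · refine (((cert_mul hne' (hg (.inr i)) (hg (.inr j))).add
        (cert_mul hne' (hg (.inl i)) (hg (.inl j)))).const_mul (r := e / 2)
        (by linarith)).congr fun z => ?_
      simp; ring
    · refine (((cert_mul hne' (hg (.inr i)) (hg (.inl j))).add
        (cert_mul hne' (hg (.inl i)) (hg (.inr j)))).const_mul (r := -e / 2)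
        (by linarith)).congr fun z => ?_
      simp; ring
  refine (((cert_of_nonneg (f := fun _ => e₀ + |e₀|) fun x => by
    linarith [neg_abs_le e₀]).add (cert_sum Finset.univ fun i _ => hlin (e₁ i) i)).add
    (cert_sum Finset.univ fun i _ => cert_sum Finset.univ fun j _ => hquad (e₂ i j) i j)).congr
    fun z => ?_
  simp only [Finset.sum_add_distrib]
  ring

/-- The modulus of continuity of the box bound. -/
def boxModulus (Q : Matrix (Fin n) (Fin n) ℝ) (c : Fin n → ℝ) (p p' : (Fin n → ℝ) × (Fin n → ℝ)) :
    ℝ :=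
  |quad Q c p.1 - quad Q c p'.1|
  + ∑ i, |p.2 i * ((Q.mulVec p.1) i + (Q.transpose.mulVec p.1) i + 2 * c i)
      - p'.2 i * ((Q.mulVec p'.1) i + (Q.transpose.mulVec p'.1) i + 2 * c i)|
  + ∑ i, ∑ j, |p.2 i * Q i j * p.2 j - p'.2 i * Q i j * p'.2 j|

theorem boxModulus_comm (Q : Matrix (Fin n) (Fin n) ℝ) (c : Fin n → ℝ)
    (p p' : (Fin n → ℝ) × (Fin n → ℝ)) : boxModulus Q c p p' = boxModulus Q c p' p := by
  unfold boxModulus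
  congr 1
  · congr 1
    · exact abs_sub_comm _ _
    · exact Finset.sum_congr rfl fun i _ => abs_sub_comm _ _
  · exact Finset.sum_congr rfl fun i _ => Finset.sum_congr rfl fun j _ => abs_sub_comm _ _

/-- On the cube, the certificate for `p'` plus one for the difference of the two scaled quadratics
is a certificate for `p`. -/
theorem Phi_le_add_boxModulus (Q : Matrix (Fin n) (Fin n) ℝ) (c : Fin n → ℝ)
    {p p' : (Fin n → ℝ) × (Fin n → ℝ)} (hp : 0 ≤ p.2) (hp' : 0 ≤ p'.2) :
    Phi Q c p'.1 p'.2 ≤ Phi Q c p.1 p.2 + boxModulus Q c p p' := by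
  have hquad : ∀ l : ℝ, IsQuad fun x => quad Q c x - l := fun l => by
    simpa [sub_eq_add_neg] using (isQuad_quad Q c).add (isQuad_const (-l))
  have h := mem_boxFeasible_iff.1 (Phi_isGreatest Q c p'.1 hp').1
  rw [cert_box_iff hp' (hquad _)] at h
  have hE := cert_cube_quadratic (quad Q c p.1 - quad Q c p'.1)
    (fun i => p.2 i * ((Q.mulVec p.1) i + (Q.transpose.mulVec p.1) i + 2 * c i)
      - p'.2 i * ((Q.mulVec p'.1) i + (Q.transpose.mulVec p'.1) i + 2 * c i))
    (fun i j => p.2 i * Q i j * p.2 j - p'.2 i * Q i j * p'.2 j)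
  have : Phi Q c p'.1 p'.2 - boxModulus Q c p p' ∈ boxFeasible Q c p.1 p.2 := by
    rw [mem_boxFeasible_iff, cert_box_iff hp (hquad _)]
    refine (h.add hE).congr fun z => ?_
    simp only [quad_scale, sub_mul, Finset.sum_sub_distrib, boxModulus]
    ring
  linarith [(Phi_isGreatest Q c p.1 hp).2 this]

theorem Phi_continuousOn (Q : Matrix (Fin n) (Fin n) ℝ) (c : Fin n → ℝ)
    (S : Set (Fin n → ℝ)) :
    ContinuousOn (fun p : (Fin n → ℝ) × (Fin n → ℝ) => Phi Q c p.1 p.2) (S ×ˢ {d | 0 ≤ d}) := by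
  intro p hp
  have hE : Continuous fun p' => boxModulus Q c p p' := by
    unfold boxModulus quad Matrix.mulVec; fun_prop
  have h0 : boxModulus Q c p p = 0 := by simp [boxModulus]
  have hlim : Tendsto (fun p' => boxModulus Q c p p') (𝓝[S ×ˢ {d | 0 ≤ d}] p) (𝓝 0) := by
    have := (hE.tendsto p).mono_left (nhdsWithin_le_nhds (s := S ×ˢ {d | 0 ≤ d}))
    rwa [h0] at this
  refine tendsto_iff_dist_tendsto_zero.2 (squeeze_zero' (Eventually.of_forall fun _ => dist_nonneg)
    ?_ hlim)
  filter_upwards [self_mem_nhdsWithin] with p' hp'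
  rw [Real.dist_eq, abs_le]
  have h1 := Phi_le_add_boxModulus Q c (p := p) (p' := p') hp.2 hp'.2
  have h2 := Phi_le_add_boxModulus Q c (p := p') (p' := p) hp'.2 hp.2
  rw [boxModulus_comm] at h2
  constructor <;> linarith

theorem Phi_zero (Q : Matrix (Fin n) (Fin n) ℝ) (c y : Fin n → ℝ) :
    Phi Q c y 0 = quad Q c y := by
  have hG := Phi_isGreatest Q c y (le_refl (0 : Fin n → ℝ))
  have hquad : ∀ l : ℝ, IsQuad fun x => quad Q c x - l := fun l => by
    simpa [sub_eq_add_neg] using (isQuad_quad Q c).add (isQuad_const (-l))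
  refine le_antisymm ?_ (hG.2 ?_)
  · have := (mem_boxFeasible_iff.1 hG.1).nonneg (x := y)
      (by rw [solSet_boxFam]; exact self_mem_box le_rfl)
    linarith
  · rw [mem_boxFeasible_iff, cert_box_iff le_rfl (hquad _)]
    exact cert_of_nonneg fun z => by simp

/-! ### Bounds for the nodes -/

/-- Lowering `ℓ` preserves feasibility, so if the unrestricted maximum exceeds `u`, the value `u`
itself is optimal. -/
theorem exists_boundOptimal {m : ℕ} {A : Matrix (Fin m) (Fin n) ℝ} {b : Fin m → ℝ}
    (hne : (polyhedron A b).Nonempty) (hb : Bornology.IsBounded (polyhedron A b))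
    (Q : Matrix (Fin n) (Fin n) ℝ) (c : Fin n → ℝ) {u : EReal} (hu : u ≠ ⊥) :
    ∃ l α, BoundOptimal A b Q c u l α := by
  obtain ⟨l, hl, hmax⟩ := (isQuad_quad Q c).exists_isGreatest_cert (g := polyFam A b)
    (by rwa [solSet_polyFam]) (by rwa [solSet_polyFam])
  by_cases h : (l : EReal) ≤ u
  · obtain ⟨α, hα⟩ := boundFeasible_iff.2 hl
    exact ⟨l, α, hα, h, fun l' α' h' _ => hmax (boundFeasible_iff.1 ⟨α', h'⟩)⟩
  · push Not at h
    lift u to ℝ using ⟨(h.trans_le le_top).ne, hu⟩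
    obtain ⟨α, hα⟩ := (boundFeasible_iff (l := u)).2 (hl.mono fun x => by
      linarith [EReal.coe_lt_coe_iff.1 h])
    exact ⟨u, α, hα, le_rfl, fun l' α' _ h' => EReal.coe_le_coe_iff.1 h'⟩

theorem BoundOptimal.le_quad {m : ℕ} {A : Matrix (Fin m) (Fin n) ℝ} {b : Fin m → ℝ}
    {Q : Matrix (Fin n) (Fin n) ℝ} {c : Fin n → ℝ} {u : EReal} {l : ℝ} {α : Fin m → AffineFn n}
    (h : BoundOptimal A b Q c u l α) {x : Fin n → ℝ} (hx : x ∈ polyhedron A b) :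
    l ≤ quad Q c x := by
  have := (boundFeasible_iff.1 ⟨α, h.1⟩).nonneg (x := x) (by rwa [solSet_polyFam])
  linarith

/-- The bound of a polyhedron contained in a box is at least the box bound. -/
theorem BoundOptimal.min_Phi_le {m : ℕ} {A : Matrix (Fin m) (Fin n) ℝ} {b : Fin m → ℝ}
    {Q : Matrix (Fin n) (Fin n) ℝ} {c : Fin n → ℝ} {u : EReal} {l : ℝ} {α : Fin m → AffineFn n}
    (h : BoundOptimal A b Q c u l α) (hne : (polyhedron A b).Nonempty) {y d : Fin n → ℝ}
    (hd : 0 ≤ d) (hsub : polyhedron A b ⊆ box y d) {r : ℝ} (hr : (r : EReal) ≤ u)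
    (hrΦ : r ≤ Phi Q c y d) : r ≤ l := by
  have h1 := mem_boxFeasible_iff.1 (Phi_isGreatest Q c y hd).1
  have h2 : Cert (polyFam A b) fun x => quad Q c x - Phi Q c y d :=
    h1.mono_set (by rwa [solSet_polyFam]) (by rwa [solSet_polyFam, solSet_boxFam])
  obtain ⟨α', hα'⟩ := boundFeasible_iff.2 (h2.mono (f' := fun x => quad Q c x - r)
    fun x => by linarith)
  exact h.2.2 r α' hα' hr

end

section

variable {n : ℕ}

/-! ### Vertices and Chebyshev centers -/

theorem isClosed_polyhedron {m : ℕ} (A : Matrix (Fin m) (Fin n) ℝ) (b : Fin m → ℝ) :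
    IsClosed (polyhedron A b) := by
  simp only [polyhedron, Set.ofPred_forall]
  refine isClosed_iInter fun i => isClosed_le ?_ continuous_const
  simp only [Matrix.mulVec]
  fun_prop

theorem isCompact_polyhedron {m : ℕ} {A : Matrix (Fin m) (Fin n) ℝ} {b : Fin m → ℝ}
    (hb : Bornology.IsBounded (polyhedron A b)) : IsCompact (polyhedron A b) :=
  Metric.isCompact_of_isClosed_isBounded (isClosed_polyhedron A b) hb

theorem convex_polyhedron {m : ℕ} (A : Matrix (Fin m) (Fin n) ℝ) (b : Fin m → ℝ) :
    Convex ℝ (polyhedron A b) := by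
  intro x hx y hy s t hs ht hst i
  rw [Matrix.mulVec_add, Matrix.mulVec_smul, Matrix.mulVec_smul]
  simp only [Pi.add_apply, Pi.smul_apply, smul_eq_mul]
  calc s * (A.mulVec x) i + t * (A.mulVec y) i ≤ s * b i + t * b i :=
        add_le_add (mul_le_mul_of_nonneg_left (hx i) hs) (mul_le_mul_of_nonneg_left (hy i) ht)
    _ = b i := by rw [← add_mul, hst, one_mul]

/-- A vertex is determined by its active constraints: if `v` and `w` share them, then `v ± t (w -
v)` is feasible for small `t > 0`, which contradicts extremality of `v`. -/
theorem finite_extremePoints_polyhedron {m : ℕ} (A : Matrix (Fin m) (Fin n) ℝ) (b : Fin m → ℝ) :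
    ((polyhedron A b).extremePoints ℝ).Finite := by
  refine Set.Finite.of_injOn (f := fun x => {i | (A.mulVec x) i = b i}) (t := Set.univ)
    (fun _ _ => mem_univ _) ?_ Set.finite_univ
  intro v hv w hw hvw
  by_contra hne
  have hvw' : ∀ i, (A.mulVec v) i = b i ↔ (A.mulVec w) i = b i := fun i =>
    Set.ext_iff.1 hvw i
  have hlin : ∀ (t : ℝ) i, (A.mulVec (v + t • (w - v))) i
      = (A.mulVec v) i + t * ((A.mulVec w) i - (A.mulVec v) i) := fun t i => by
    rw [Matrix.mulVec_add, Matrix.mulVec_smul, Matrix.mulVec_sub]; simp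
  have hev : ∀ᶠ t : ℝ in 𝓝 0, v + t • (w - v) ∈ polyhedron A b := by
    refine Filter.eventually_all.2 fun i => ?_
    simp only [hlin]
    by_cases hi : (A.mulVec v) i = b i
    · refine Eventually.of_forall fun t => ?_
      rw [(hvw' i).1 hi, hi]; simp
    · have hlt := lt_of_le_of_ne (hv.1 i) hi
      have hc : ContinuousAt
          (fun t : ℝ => (A.mulVec v) i + t * ((A.mulVec w) i - (A.mulVec v) i)) 0 := by fun_prop
      filter_upwards [hc.eventually_lt_const (by simpa using hlt)] with t ht using ht.le
  have hev' : ∀ᶠ t : ℝ in 𝓝 0, v + (-t) • (w - v) ∈ polyhedron A b := by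
    have : Tendsto (fun t : ℝ => -t) (𝓝 0) (𝓝 0) := by simpa using (continuous_neg.tendsto (0 : ℝ))
    exact this.eventually hev
  obtain ⟨t, ⟨h1, h2⟩, ht⟩ := (((hev.and hev').filter_mono nhdsWithin_le_nhds).and
    (self_mem_nhdsWithin (s := Ioi (0 : ℝ)))).exists
  have h3 := mem_extremePoints.1 hv |>.2 _ h1 _ h2 ⟨1 / 2, 1 / 2, by norm_num, by norm_num,
    by norm_num, by module⟩
  have h4 : t • (w - v) = 0 := by simpa using h3.1
  rcases smul_eq_zero.1 h4 with h | h
  · exact (ne_of_gt ht) h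
  · exact hne (sub_eq_zero.1 h).symm

/-- By Krein–Milman and finiteness of the vertex set, the polytope is the convex hull of its
vertices, where a concave function attains its minimum. -/
theorem exists_vertex_isMinOn {m : ℕ} {A : Matrix (Fin m) (Fin n) ℝ} {b : Fin m → ℝ}
    (hne : (polyhedron A b).Nonempty) (hb : Bornology.IsBounded (polyhedron A b))
    {f : (Fin n → ℝ) → ℝ} (hf : ConcaveOn ℝ univ f) :
    ∃ v ∈ (polyhedron A b).extremePoints ℝ, ∀ x ∈ polyhedron A b, f v ≤ f x := by
  have hfin := finite_extremePoints_polyhedron A b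
  have hcomp := isCompact_polyhedron hb
  obtain ⟨v, hv, hmin⟩ := hfin.toFinset.exists_min_image f
    (by simpa using hcomp.extremePoints_nonempty hne)
  refine ⟨v, by simpa using hv, fun x hx => ?_⟩
  have hx' : x ∈ convexHull ℝ ((polyhedron A b).extremePoints ℝ) := by
    rw [← (hfin.isClosed_convexHull ℝ).closure_eq,
      closure_convexHull_extremePoints hcomp (convex_polyhedron A b)]
    exact hx
  obtain ⟨w, hw, hwx⟩ := hf.exists_le_of_mem_convexHull (subset_univ _) hx'
  exact (hmin w (by simpa using hw)).trans hwx

theorem dotProduct_mulVec_nonpos {Q : Matrix (Fin n) (Fin n) ℝ} (hQ : (-Q).PosSemidef)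
    (x : Fin n → ℝ) : x ⬝ᵥ Q.mulVec x ≤ 0 := by
  have := hQ.dotProduct_mulVec_nonneg x
  simpa [Matrix.neg_mulVec] using this

theorem dotProduct_mulVec_symm {Q : Matrix (Fin n) (Fin n) ℝ} (hQ : (-Q).PosSemidef)
    (x y : Fin n → ℝ) : x ⬝ᵥ Q.mulVec y = y ⬝ᵥ Q.mulVec x := by
  have h : Q.transpose = Q := by
    ext i j
    simpa using hQ.isHermitian.apply i j
  rw [Matrix.dotProduct_mulVec, ← Matrix.mulVec_transpose, h, dotProduct_comm]

theorem concaveOn_quad {Q : Matrix (Fin n) (Fin n) ℝ} (hQ : (-Q).PosSemidef) (c : Fin n → ℝ) :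
    ConcaveOn ℝ univ (quad Q c) := by
  refine ⟨convex_univ, fun x _ y _ s t hs ht hst => ?_⟩
  have h := mul_nonneg (mul_nonneg hs ht) (neg_nonneg.2 (dotProduct_mulVec_nonpos hQ (x - y)))
  have ht' : t = 1 - s := by linarith
  subst ht'
  simp only [quad, Matrix.mulVec_add, Matrix.mulVec_smul, Matrix.mulVec_sub, dotProduct_add,
    add_dotProduct, dotProduct_sub, sub_dotProduct, smul_dotProduct, dotProduct_smul,
    smul_eq_mul] at h ⊢
  nlinarith

theorem isQuad_penalized {m : ℕ} (A : Matrix (Fin m) (Fin n) ℝ) (b : Fin m → ℝ)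
    (Q : Matrix (Fin n) (Fin n) ℝ) (c : Fin n → ℝ) (α : Fin m → AffineFn n) :
    IsQuad (penalized A b Q c α) := by
  have := (isQuad_quad Q c).add (isQuad_sum (Finset.univ : Finset (Fin m)) fun i _ =>
    isQuad_mul (-α i) (polyFam A b i))
  convert this using 2 with x
  rw [sum_polyFam]
  simp [sub_eq_add_neg]

/-- A vertex that minimizes `q` globally meets every requirement at once. -/
theorem exists_foundVertex {m : ℕ} {A : Matrix (Fin m) (Fin n) ℝ} {b : Fin m → ℝ}
    (hne : (polyhedron A b).Nonempty) (hb : Bornology.IsBounded (polyhedron A b))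
    {Q : Matrix (Fin n) (Fin n) ℝ} (hQ : (-Q).PosSemidef) (c : Fin n → ℝ)
    {g : (Fin n → ℝ) → ℝ} (hg : Continuous g) :
    ∃ v, FoundVertex (polyhedron A b) g (quad Q c) v := by
  obtain ⟨v, hv, hmin⟩ := exists_vertex_isMinOn hne hb (concaveOn_quad hQ c)
  obtain ⟨z, hz, hzmin⟩ := (isCompact_polyhedron hb).exists_isMinOn hne hg.continuousOn
  exact ⟨v, ⟨hv, fun w hw => hmin w (extremePoints_subset hw.2.2.1)⟩, z, hz, hzmin, hmin z hz⟩

theorem exists_isChebyshevCenter {S : Set (Fin n → ℝ)} (hne : S.Nonempty) (hS : IsCompact S) :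
    ∃ x, IsChebyshevCenter S x := by
  have hc : Continuous fun z : Fin n → ℝ => Metric.infDist (WithLp.toLp 2 z) (toEuclid S)ᶜ :=
    (Metric.continuous_infDist_pt _).comp (PiLp.continuous_toLp 2 _)
  obtain ⟨x, hx, hmax⟩ := hS.exists_isMaxOn hne hc.continuousOn
  exact ⟨x, hx, fun z hz => hmax hz⟩

/-- The sup norm distance of two points of a bounded set is at most its Euclidean diameter. -/
theorem abs_sub_le_euclidDiam {S : Set (Fin n → ℝ)} (hS : IsCompact S) {x y : Fin n → ℝ}
    (hx : x ∈ S) (hy : y ∈ S) (i : Fin n) : |x i - y i| ≤ euclidDiam S := by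
  have hb : Bornology.IsBounded (toEuclid S) :=
    (hS.image (PiLp.continuous_toLp 2 _)).isBounded
  have h1 := Metric.dist_le_diam_of_mem hb (mem_image_of_mem (WithLp.toLp 2) hx)
    (mem_image_of_mem (WithLp.toLp 2) hy)
  refine le_trans ?_ h1
  have := PiLp.norm_apply_le (WithLp.toLp 2 x - WithLp.toLp 2 y : EuclideanSpace ℝ (Fin n)) i
  rw [dist_eq_norm]
  simpa using this

end

section

variable {n : ℕ}

/-! ### Validity of Konno's cut -/

/-- The supremum defining a step length may be infinite or not attained; an element of `Θ` whose
reciprocal is within `η` of the reciprocal of the supremum serves instead. -/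
theorem exists_mem_inv_le {Θ : Set ℝ} (hpos : 0 < sSup ((fun θ : ℝ => (θ : EReal)) '' Θ)) {η : ℝ}
    (hη : 0 < η) :
    ∃ θ ∈ Θ, 0 < θ ∧ θ⁻¹ ≤ ((sSup ((fun θ : ℝ => (θ : EReal)) '' Θ))⁻¹).toReal + η := by
  set s := sSup ((fun θ : ℝ => (θ : EReal)) '' Θ) with hs
  have key : ∀ r : ℝ, (r : EReal) < s → ∃ θ ∈ Θ, r < θ := fun r hr => by
    obtain ⟨_, ⟨θ, hθ, rfl⟩, h⟩ := lt_sSup_iff.1 hr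
    exact ⟨θ, hθ, EReal.coe_lt_coe_iff.1 h⟩
  clear_value s
  induction s with
  | bot => exact absurd hpos not_lt_bot
  | top =>
    obtain ⟨θ, hθ, h⟩ := key η⁻¹ (EReal.coe_lt_top _)
    have hη' := inv_pos.2 hη
    refine ⟨θ, hθ, hη'.trans h, ?_⟩
    rw [EReal.inv_top, EReal.toReal_zero, zero_add]
    exact inv_le_of_inv_le₀ hη h.le
  | coe r =>
    have hr : 0 < r := EReal.coe_pos.1 hpos
    have hr' := inv_pos.2 hr
    have h1 : (r⁻¹ + η)⁻¹ < r := by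
      rw [inv_lt_comm₀ (by linarith) hr]; linarith
    obtain ⟨θ, hθ, h⟩ := key _ (EReal.coe_lt_coe_iff.2 h1)
    have h2 : 0 < (r⁻¹ + η)⁻¹ := inv_pos.2 (by linarith)
    refine ⟨θ, hθ, h2.trans h, ?_⟩
    rw [← EReal.coe_inv, EReal.toReal_coe]
    exact inv_le_of_inv_le₀ (by linarith) h.le

/-- The strict inequality leaves slack `1 - σ`, which pays for replacing the suprema by actual
elements; adding `1` to the denominator of the tolerance covers `ξ = 0`. -/
theorem exists_steps {Θ : Fin n → Set ℝ}
    (hpos : ∀ i, 0 < sSup ((fun θ : ℝ => (θ : EReal)) '' Θ i)) {ξ : Fin n → ℝ} (hξ : ∀ i, 0 ≤ ξ i)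
    (hsum : ∑ i, ξ i * ((sSup ((fun θ : ℝ => (θ : EReal)) '' Θ i))⁻¹).toReal < 1) :
    ∃ θ : Fin n → ℝ, (∀ i, θ i ∈ Θ i) ∧ (∀ i, 0 < θ i) ∧ ∑ i, ξ i / θ i ≤ 1 := by
  have hξ' : 0 ≤ ∑ i, ξ i := Finset.sum_nonneg fun i _ => hξ i
  set σ := ∑ i, ξ i * ((sSup ((fun θ : ℝ => (θ : EReal)) '' Θ i))⁻¹).toReal with hσ
  have hη : 0 < (1 - σ) / (1 + ∑ i, ξ i) := div_pos (by linarith) (by linarith)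
  choose θ hθ hθpos hle using fun i => exists_mem_inv_le (hpos i) hη
  refine ⟨θ, hθ, hθpos, ?_⟩
  calc ∑ i, ξ i / θ i ≤ ∑ i, (ξ i * ((sSup ((fun θ : ℝ => (θ : EReal)) '' Θ i))⁻¹).toReal
        + ξ i * ((1 - σ) / (1 + ∑ i, ξ i))) := Finset.sum_le_sum fun i _ => by
        rw [div_eq_mul_inv, ← mul_add]; exact mul_le_mul_of_nonneg_left (hle i) (hξ i)
    _ = σ + (∑ i, ξ i) * ((1 - σ) / (1 + ∑ i, ξ i)) := by
        rw [Finset.sum_add_distrib, ← Finset.sum_mul]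
    _ ≤ σ + (1 - σ) := by
        gcongr
        rw [mul_div_assoc', div_le_iff₀ (by linarith)]
        nlinarith
    _ = 1 := by ring

theorem cutNormal_dotProduct {e : Fin n → Fin n → ℝ} (he : LinearIndependent ℝ e)
    (s : Fin n → EReal) (ξ : Fin n → ℝ) :
    cutNormal e s ⬝ᵥ (∑ i, ξ i • e i) = ∑ i, ξ i * ((s i)⁻¹).toReal := by
  have hu : IsUnit (Matrix.of e) := Matrix.linearIndependent_rows_iff_isUnit.1 he
  have h : (Matrix.of e).mulVec (cutNormal e s) = fun i => ((s i)⁻¹).toReal := by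
    rw [cutNormal, Matrix.mulVec_mulVec, Matrix.mul_nonsing_inv _
      ((Matrix.isUnit_iff_isUnit_det _).1 hu), Matrix.one_mulVec]
  rw [dotProduct_sum]
  refine Finset.sum_congr rfl fun i _ => ?_
  rw [dotProduct_smul, smul_eq_mul, dotProduct_comm, ← congrFun h i]
  rfl

variable {m : ℕ} {A : Matrix (Fin m) (Fin n) ℝ} {b : Fin m → ℝ}
  {Q : Matrix (Fin n) (Fin n) ℝ} {c : Fin n → ℝ} {S : Set (Fin n → ℝ)} {u ε : ℝ} {v : Fin n → ℝ}
  {e y : Fin n → Fin n → ℝ}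

theorem quad_add (hQ : (-Q).PosSemidef) (c v w : Fin n → ℝ) :
    quad Q c (v + w) = quad Q c v + 2 * ((Q.mulVec v + c) ⬝ᵥ w) + w ⬝ᵥ Q.mulVec w := by
  simp only [quad, Matrix.mulVec_add, dotProduct_add, add_dotProduct]
  rw [dotProduct_mulVec_symm hQ v w, dotProduct_comm (Q.mulVec v) w]
  ring

theorem tuyStep_pos (huv : u ≤ quad Q c v) (hε : 0 < ε) (i : Fin n) :
    0 < tuyStep Q c u ε v e i := by
  have hc : ContinuousAt (fun θ : ℝ => quad Q c (v + θ • e i)) 0 :=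
    ((isQuad_quad Q c).continuous.comp (by fun_prop)).continuousAt
  obtain ⟨θ, h, hθ⟩ := (((hc.eventually_const_lt (u := u - ε) (by simp; linarith)).filter_mono
    nhdsWithin_le_nhds).and (self_mem_nhdsWithin (s := Ioi (0 : ℝ)))).exists
  exact lt_of_lt_of_le (EReal.coe_pos.2 hθ) (le_sSup ⟨θ, h.le, rfl⟩)

/-- Tuy's cut only cuts off points that are not better than `u - ε`. -/
theorem tuy_cut_valid (hQ : (-Q).PosSemidef) (huv : u ≤ quad Q c v) (hε : 0 < ε)
    (he : LinearIndependent ℝ e) {ξ : Fin n → ℝ} (hξ : ∀ i, 0 ≤ ξ i)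
    (hcut : tuyNormal Q c u ε v e ⬝ᵥ (∑ i, ξ i • e i) < 1) :
    u - ε ≤ quad Q c (v + ∑ i, ξ i • e i) := by
  rw [tuyNormal, cutNormal_dotProduct he] at hcut
  obtain ⟨θ, hθ, hθpos, hle⟩ := exists_steps (tuyStep_pos huv hε) hξ hcut
  have hconv : Convex ℝ {x ∈ univ | u - ε ≤ quad Q c x} := (concaveOn_quad hQ c).convex_ge _
  -- The point is the convex combination of `v` and the points `v + θᵢ eᵢ` with weights `1 - ∑
  -- ξᵢ/θᵢ` and `ξᵢ/θᵢ`; all of these lie in a superlevel set of the concave `q`.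
  let w : Option (Fin n) → ℝ := fun o => o.elim (1 - ∑ i, ξ i / θ i) fun i => ξ i / θ i
  let p : Option (Fin n) → Fin n → ℝ := fun o => o.elim v fun i => v + θ i • e i
  have hmem := hconv.sum_mem (t := Finset.univ) (w := w) (z := p)
    (by
      rintro (_ | i) _
      · exact sub_nonneg.2 hle
      · exact div_nonneg (hξ i) (hθpos i).le)
    (by simp [Fintype.sum_option, w])
    (by
      rintro (_ | i) _
      · exact ⟨mem_univ _, show u - ε ≤ quad Q c v by linarith⟩
      · exact ⟨mem_univ _, hθ i⟩)
  have hsum : ∑ o, w o • p o = v + ∑ i, ξ i • e i := by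
    simp only [Fintype.sum_option, w, p, Option.elim, smul_add, Finset.sum_add_distrib,
      ← Finset.sum_smul, smul_smul]
    have : ∀ i, ξ i / θ i * θ i = ξ i := fun i => div_mul_cancel₀ _ (hθpos i).ne'
    simp only [this]
    module
  rw [hsum] at hmem
  exact hmem.2

/-- Konno's cut only cuts off points that are not better than `u - ε`. -/
theorem konno_cut_valid (hQ : (-Q).PosSemidef) (huv : u ≤ quad Q c v) (hε : 0 < ε)
    (hdata : KonnoData A b Q c S u ε v e y) (helig : Eligible A b Q c u ε v e y)
    {x : Fin n → ℝ} (hxS : x ∈ S) (hx : x ∈ polyhedron A b)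
    (hcut : konnoNormal A b Q c u ε v e ⬝ᵥ (x - v) < 1) : u - ε ≤ quad Q c x := by
  obtain ⟨⟨he, -, hcoord⟩, hy⟩ := hdata
  obtain ⟨hyq, hspos⟩ := helig
  obtain ⟨ξ, hξ, hxξ⟩ := hcoord x hxS
  by_cases ht : tuyNormal Q c u ε v e ⬝ᵥ (x - v) < 1
  · rw [hxξ, add_sub_cancel_left] at ht
    rw [hxξ]
    exact tuy_cut_valid hQ huv hε he hξ ht
  push Not at ht
  set w := x - v with hw
  have hwξ : w = ∑ i, ξ i • e i := by rw [hw, hxξ, add_sub_cancel_left]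
  rw [hwξ, konnoNormal, cutNormal_dotProduct he] at hcut
  obtain ⟨θ, hθ, hθpos, hle⟩ := exists_steps hspos hξ hcut
  -- From here on, the bilinear form `q(v) + (Qv + c)ᵀ(w + z) + wᵀQz` is followed as an affine
  -- function of `z`. At `z = 0` it is the average of `q(v)` and `q(v) + 2(Qv + c)ᵀw`. The latter is
  -- at least `u - ε` by minimality of `yⁱ` and the eligibility test, as the quadratic term at `yⁱ`
  -- is nonpositive.
  have h₀ : 0 ≤ quad Q c v + (Q.mulVec v + c) ⬝ᵥ w - (u - ε) := by
    rcases isEmpty_or_nonempty (Fin n) with hn | ⟨⟨i⟩⟩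
    · rw [dotProduct, Finset.univ_eq_empty, Finset.sum_empty] at ht
      linarith
    · have h1 := hyq i
      have h2 := (hy i).2 (show x ∈ tuyRegion A b Q c u ε v e from ⟨hx, ht⟩)
      have h3 := quad_add hQ c v (y i - v)
      rw [add_sub_cancel] at h3
      have h4 := dotProduct_mulVec_nonpos hQ (y i - v)
      simp only [mem_ofPred_eq] at h2
      rw [dotProduct_sub] at h3
      rw [hw, dotProduct_sub]
      linarith
  -- At `z = θᵢ eᵢ` the system defining the step is a dual certificate; `w` satisfies `A w ≤ b - A
  -- v` and Tuy's cut, so weak duality applies.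
  have hk : ∀ i, 0 ≤ quad Q c v + (Q.mulVec v + c) ⬝ᵥ w - (u - ε)
      + θ i * ((Q.mulVec v + c) ⬝ᵥ e i + w ⬝ᵥ Q.mulVec (e i)) := fun i => by
    obtain ⟨lam, μ, hlam, hμ, heq, hineq⟩ := hθ i
    have h1 : w ⬝ᵥ (-(A.transpose.mulVec lam) + μ • tuyNormal Q c u ε v e
        - θ i • Q.mulVec (e i)) = w ⬝ᵥ (Q.mulVec v + c) := by rw [heq]
    simp only [dotProduct_sub, dotProduct_add, dotProduct_neg, dotProduct_smul, smul_eq_mul] at h1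
    have h2 : w ⬝ᵥ A.transpose.mulVec lam ≤ (b - A.mulVec v) ⬝ᵥ lam := by
      rw [Matrix.mulVec_transpose, dotProduct_comm, ← Matrix.dotProduct_mulVec, dotProduct_comm]
      refine Finset.sum_le_sum fun j _ => mul_le_mul_of_nonneg_right ?_ (hlam j)
      rw [hw, Matrix.mulVec_sub]
      simpa using hx j
    have h3 : μ ≤ μ * (w ⬝ᵥ tuyNormal Q c u ε v e) := by
      rw [dotProduct_comm]; nlinarith
    rw [dotProduct_comm w (Q.mulVec v), dotProduct_comm w c, ← add_dotProduct] at h1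
    linarith
  have hquad : quad Q c x = quad Q c v + (Q.mulVec v + c) ⬝ᵥ w
      + ∑ i, ξ i * ((Q.mulVec v + c) ⬝ᵥ e i + w ⬝ᵥ Q.mulVec (e i)) := by
    have h1 := quad_add hQ c v w
    rw [hw, add_sub_cancel, ← hw] at h1
    have h2 : (Q.mulVec v + c) ⬝ᵥ w + w ⬝ᵥ Q.mulVec w
        = ∑ i, ξ i * ((Q.mulVec v + c) ⬝ᵥ e i + w ⬝ᵥ Q.mulVec (e i)) := by
      conv_lhs => rw [show Q.mulVec w = ∑ i, ξ i • Q.mulVec (e i) by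
        rw [hwξ, Matrix.mulVec_sum]; simp only [Matrix.mulVec_smul]]
      conv_lhs => enter [1, 2]; rw [hwξ]
      simp only [dotProduct_sum, dotProduct_smul, smul_eq_mul, mul_add, Finset.sum_add_distrib]
    rw [h1, ← h2]; ring
  set h := quad Q c v + (Q.mulVec v + c) ⬝ᵥ w - (u - ε)
  -- At `z = w` the form equals `q(x)`, and `w` is a convex combination of `0` and the points `θᵢ
  -- eᵢ`.
  have hsum : -h ≤ ∑ i, ξ i * ((Q.mulVec v + c) ⬝ᵥ e i + w ⬝ᵥ Q.mulVec (e i)) := by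
    calc -h ≤ -((∑ i, ξ i / θ i) * h) := by nlinarith
      _ = ∑ i, (ξ i / θ i) * (-h) := by rw [← Finset.sum_mul]; ring
      _ ≤ _ := Finset.sum_le_sum fun i _ => by
        have h1 := mul_le_mul_of_nonneg_left
          (show -h ≤ θ i * ((Q.mulVec v + c) ⬝ᵥ e i + w ⬝ᵥ Q.mulVec (e i)) by linarith [hk i])
          (div_nonneg (hξ i) (hθpos i).le)
        refine h1.trans_eq ?_
        rw [← mul_assoc, div_mul_cancel₀ _ (hθpos i).ne']
  rw [hquad]
  linarith

end

section

/-! ### The steps of the algorithm -/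

variable {n m : ℕ} {A : Matrix (Fin m) (Fin n) ℝ} {b : Fin m → ℝ}
  {Q : Matrix (Fin n) (Fin n) ℝ} {c : Fin n → ℝ} {ε : ℝ}

theorem Node.mem_set_addIneq {N : Node n} {a : Fin n → ℝ} {β : ℝ} {x : Fin n → ℝ} :
    x ∈ (N.addIneq a β).set ↔ a ⬝ᵥ x ≤ β ∧ x ∈ N.set := by
  simp only [Node.set, Node.addIneq, polyhedron, mem_ofPred_eq, Fin.forall_fin_succ, Fin.cons_zero,
    Fin.cons_succ, Matrix.mulVec, Matrix.of_apply]

theorem Node.mem_set_child {N : Node n} {k : ℕ} {a : Fin n → ℝ} {β : ℝ} {x : Fin n → ℝ} :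
    x ∈ (N.child k a β).set ↔ a ⬝ᵥ x ≤ β ∧ x ∈ N.set :=
  Node.mem_set_addIneq (N := N)

theorem Bounding.upper_le {u : EReal} {N : Node n} {l : ℝ} {α : Fin N.m → AffineFn n} {u₁ : ℝ}
    (h : Bounding A b Q c u N l α u₁) : (u₁ : EReal) ≤ u := by
  obtain ⟨-, v, -, h⟩ := h
  rw [h]; exact min_le_left _ _

theorem Bounding.exists_eq {u : EReal} {N : Node n} {l : ℝ} {α : Fin N.m → AffineFn n} {u₁ : ℝ}
    (h : Bounding A b Q c u N l α u₁)
    (hu : u = ⊤ ∨ ∃ x ∈ polyhedron A b, u = (quad Q c x : ℝ)) :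
    ∃ x ∈ polyhedron A b, u₁ = quad Q c x := by
  obtain ⟨-, v, hv, h⟩ := h
  have hvX : v ∈ polyhedron A b := extremePoints_subset hv.1.1
  rcases hu with rfl | ⟨x, hx, rfl⟩
  · rw [min_eq_right le_top] at h
    exact ⟨v, hvX, EReal.coe_eq_coe_iff.1 h⟩
  · rcases min_choice ((quad Q c x : ℝ) : EReal) (quad Q c v : ℝ) with h' | h' <;> rw [h'] at h
    · exact ⟨x, hx, EReal.coe_eq_coe_iff.1 h⟩
    · exact ⟨v, hvX, EReal.coe_eq_coe_iff.1 h⟩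

theorem exists_bounding (hne : (polyhedron A b).Nonempty)
    (hb : Bornology.IsBounded (polyhedron A b)) (hQ : (-Q).PosSemidef) {u : EReal} (hu : u ≠ ⊥)
    {N : Node n} (hN : N.set.Nonempty) (hNX : N.set ⊆ polyhedron A b) :
    ∃ l α u₁, Bounding A b Q c u N l α u₁ := by
  obtain ⟨l, α, h⟩ := exists_boundOptimal hN (hb.subset hNX) Q c hu
  obtain ⟨v, hv⟩ := exists_foundVertex hne hb hQ c (isQuad_penalized N.A N.b Q c α).continuous
  have hne_top : min u (quad Q c v : ℝ) ≠ ⊤ :=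
    ((min_le_right _ _).trans_lt (EReal.coe_lt_top _)).ne
  have hne_bot : min u (quad Q c v : ℝ) ≠ ⊥ := by
    rcases min_choice u ((quad Q c v : ℝ) : EReal) with h | h <;> rw [h]
    · exact hu
    · exact EReal.coe_ne_bot _
  exact ⟨l, α, (min u (quad Q c v : ℝ)).toReal, h, v, hv, EReal.coe_toReal hne_top hne_bot⟩

theorem CutStep.subset {u : ℝ} {v : Fin n → ℝ} {N N' : Node n}
    (h : CutStep A b Q c u ε v N N') : N'.set ⊆ N.set := by
  cases h with
  | cut e y hdata helig => exact fun x hx => (Node.mem_set_addIneq.1 hx).2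
  | keep h => exact subset_rfl

theorem CutStep.id_eq {u : ℝ} {v : Fin n → ℝ} {N N' : Node n}
    (h : CutStep A b Q c u ε v N N') : N'.id = N.id := by
  cases h <;> rfl

theorem CutStep.valid (hQ : (-Q).PosSemidef) (hε : 0 < ε) {u : ℝ} {v : Fin n → ℝ}
    (huv : u ≤ quad Q c v) {N N' : Node n} (hNX : N.set ⊆ polyhedron A b)
    (h : CutStep A b Q c u ε v N N') {x : Fin n → ℝ} (hx : x ∈ N.set) (hx' : x ∉ N'.set) :
    u - ε ≤ quad Q c x := by
  cases h with
  | cut e y hdata helig =>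
    rw [Node.mem_set_addIneq] at hx'
    refine konno_cut_valid hQ huv hε hdata helig hx (hNX hx) ?_
    by_contra hcon
    refine hx' ⟨?_, hx⟩
    rw [dotProduct_sub] at hcon
    rw [neg_dotProduct]
    linarith
  | keep h => exact absurd hx hx'

theorem exists_cutting (hb : Bornology.IsBounded (polyhedron A b)) (hQ : (-Q).PosSemidef)
    (c : Fin n → ℝ) (ε u₁ : ℝ) {N : Node n} (hN : N.set.Nonempty) (hNX : N.set ⊆ polyhedron A b)
    (α : Fin N.m → AffineFn n) : ∃ u₂ N', Cutting A b Q c ε u₁ N α u₂ N' := by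
  obtain ⟨v, hv⟩ := exists_foundVertex hN (hb.subset hNX) hQ c
    (isQuad_penalized N.A N.b Q c α).continuous
  by_cases h : ∃ e y, KonnoData A b Q c N.set (min u₁ (quad Q c v)) ε v e y ∧
      Eligible A b Q c (min u₁ (quad Q c v)) ε v e y
  · obtain ⟨e, y, h, h'⟩ := h
    exact ⟨_, _, v, hv, rfl, .cut e y h h'⟩
  · push Not at h
    exact ⟨_, _, v, hv, rfl, .keep (.inl h)⟩

theorem Cutting.subset {u₁ u₂ : ℝ} {N N' : Node n} {α : Fin N.m → AffineFn n}
    (h : Cutting A b Q c ε u₁ N α u₂ N') : N'.set ⊆ N.set := by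
  obtain ⟨v, -, -, h⟩ := h
  exact h.subset

theorem Cutting.id_eq {u₁ u₂ : ℝ} {N N' : Node n} {α : Fin N.m → AffineFn n}
    (h : Cutting A b Q c ε u₁ N α u₂ N') : N'.id = N.id := by
  obtain ⟨v, -, -, h⟩ := h
  exact h.id_eq

theorem Cutting.upper_le {u₁ u₂ : ℝ} {N N' : Node n} {α : Fin N.m → AffineFn n}
    (h : Cutting A b Q c ε u₁ N α u₂ N') : u₂ ≤ u₁ := by
  obtain ⟨v, -, rfl, -⟩ := h
  exact min_le_left _ _

/-- Supplies the center of the box in the termination argument: a point of the node at which `q` has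
been compared with `u`. -/
theorem Cutting.exists_le {u₁ u₂ : ℝ} {N N' : Node n} {α : Fin N.m → AffineFn n}
    (h : Cutting A b Q c ε u₁ N α u₂ N') : ∃ v ∈ N.set, u₂ ≤ quad Q c v := by
  obtain ⟨v, hv, rfl, -⟩ := h
  exact ⟨v, extremePoints_subset hv.1.1, min_le_right _ _⟩

theorem Cutting.exists_eq {u₁ u₂ : ℝ} {N N' : Node n} {α : Fin N.m → AffineFn n}
    (hNX : N.set ⊆ polyhedron A b) (h : Cutting A b Q c ε u₁ N α u₂ N')
    (hu : ∃ x ∈ polyhedron A b, u₁ = quad Q c x) : ∃ x ∈ polyhedron A b, u₂ = quad Q c x := by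
  obtain ⟨v, hv, rfl, -⟩ := h
  rcases min_choice u₁ (quad Q c v) with h' | h' <;> rw [h']
  · exact hu
  · exact ⟨v, hNX (extremePoints_subset hv.1.1), rfl⟩

theorem Cutting.valid (hQ : (-Q).PosSemidef) (hε : 0 < ε) {u₁ u₂ : ℝ} {N N' : Node n}
    {α : Fin N.m → AffineFn n} (hNX : N.set ⊆ polyhedron A b)
    (h : Cutting A b Q c ε u₁ N α u₂ N') {x : Fin n → ℝ} (hx : x ∈ N.set) (hx' : x ∉ N'.set) :
    u₂ ≤ quad Q c x + ε := by
  obtain ⟨v, -, hu, h⟩ := h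
  linarith [h.valid hQ hε (hu ▸ min_le_right _ _) hNX hx hx']

/-! ### Invariants -/

/-- The invariants of the algorithm. The nodes of the current round have their numbers in
`(S, T]`, their fathers have numbers up to `S`, and the nodes of the next round have numbers
above `T`. -/
structure Inv (A : Matrix (Fin m) (Fin n) ℝ) (b : Fin m → ℝ) (Q : Matrix (Fin n) (Fin n) ℝ)
    (c : Fin n → ℝ) (ε : ℝ) (S T : ℕ) (σ : State n) : Prop where
  lt : S < T
  le_count : T ≤ σ.count
  node_set : ∀ N ∈ σ.active + σ.next, N.set.Nonempty ∧ N.set ⊆ polyhedron A b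
  active_id : ∀ N ∈ σ.active, S < N.id ∧ N.id ≤ T ∧ N.father ≤ S
  next_id : ∀ N ∈ σ.next, T < N.id ∧ N.id ≤ σ.count ∧ S < N.father ∧ N.father ≤ T
  next_bound : ∀ N ∈ σ.next, ∃ l, (N.father, l) ∈ σ.bounds ∧ ∀ z ∈ N.set, l ≤ quad Q c z
  upper : (σ.upper = ⊤ ∧ σ.active ≠ 0) ∨ ∃ x ∈ polyhedron A b, σ.upper = (quad Q c x : ℝ)
  cover : ∀ z ∈ polyhedron A b, σ.upper ≤ ((quad Q c z + ε : ℝ) : EReal) ∨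
    ∃ N ∈ σ.active + σ.next, z ∈ N.set

theorem inv_initState (hne : (polyhedron A b).Nonempty) :
    Inv A b Q c ε 0 1 (initState A b) where
  lt := Nat.zero_lt_one
  le_count := le_rfl
  node_set := fun N hN => by
    simp only [initState, add_zero, Multiset.mem_singleton] at hN
    subst hN
    exact ⟨hne, subset_rfl⟩
  active_id := fun N hN => by
    simp only [initState, Multiset.mem_singleton] at hN
    subst hN
    exact ⟨Nat.zero_lt_one, le_rfl, le_rfl⟩
  next_id := fun N hN => by simp [initState] at hN
  next_bound := fun N hN => by simp [initState] at hN
  upper := .inl ⟨rfl, by simp [initState]⟩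
  cover := fun z hz => .inr ⟨⟨1, 0, m, A, b⟩, by simp [initState], hz⟩

section

variable {S T : ℕ} {σ τ : State n}

/-- The invariants after a node `N` has been processed and replaced by a list `D` of sons. -/
theorem Inv.process (h : Inv A b Q c ε S T σ) {N : Node n} {rest D : Multiset (Node n)} {l u : ℝ}
    (hsel : σ.active = N ::ₘ rest) (hl : ∀ z ∈ N.set, l ≤ quad Q c z)
    (hu : (u : EReal) ≤ σ.upper) (hux : ∃ x ∈ polyhedron A b, u = quad Q c x) {k : ℕ}
    (hk : σ.count ≤ k)
    (hD : ∀ M ∈ D, M.set.Nonempty ∧ M.set ⊆ N.set ∧ σ.count < M.id ∧ M.id ≤ k ∧ M.father = N.id)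
    (hcover : ∀ z ∈ N.set, u ≤ quad Q c z + ε ∨ ∃ M ∈ D, z ∈ M.set) :
    Inv A b Q c ε S T { σ with
      active := rest
      next := D + σ.next
      bounds := updateBounds σ.bounds N l
      upper := u
      count := k } := by
  have hN : N ∈ σ.active := by rw [hsel]; exact Multiset.mem_cons_self _ _
  have hNid := h.active_id N hN
  have hrest : ∀ M ∈ rest, M ∈ σ.active := fun M hM => by
    rw [hsel]; exact Multiset.mem_cons_of_mem hM
  obtain ⟨x, hx, hux⟩ := hux
  refine ⟨h.lt, h.le_count.trans hk, fun M hM => ?_, fun M hM => h.active_id M (hrest M hM),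
    fun M hM => ?_, fun M hM => ?_, .inr ⟨x, hx, by rw [hux]⟩, fun z hz => ?_⟩
  · simp only [Multiset.mem_add] at hM
    rcases hM with hM | hM | hM
    · exact h.node_set M (Multiset.mem_add.2 (.inl (hrest M hM)))
    · obtain ⟨h1, h2, -⟩ := hD M hM
      exact ⟨h1, h2.trans (h.node_set N (Multiset.mem_add.2 (.inl hN))).2⟩
    · exact h.node_set M (Multiset.mem_add.2 (.inr hM))
  · rcases Multiset.mem_add.1 hM with hM | hM
    · obtain ⟨-, -, h1, h2, h3⟩ := hD M hM
      exact ⟨h.le_count.trans_lt h1, h2, by rw [h3]; exact hNid.1, by rw [h3]; exact hNid.2.1⟩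
    · obtain ⟨h1, h2, h3⟩ := h.next_id M hM
      exact ⟨h1, h2.trans hk, h3⟩
  · rcases Multiset.mem_add.1 hM with hM | hM
    · obtain ⟨-, h2, -, -, h3⟩ := hD M hM
      exact ⟨l, by rw [h3]; exact List.mem_cons_self, fun z hz => hl z (h2 hz)⟩
    · obtain ⟨l', h1, h2⟩ := h.next_bound M hM
      -- The deleted entry belongs to the father of `N`, whose number is at most `S`; nodes of the
      -- next round have fathers numbered above `S`, so their entries survive.
      refine ⟨l', List.mem_cons_of_mem _ (List.mem_filter.2 ⟨h1, ?_⟩), h2⟩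
      have := (h.next_id M hM).2.2.1
      simp only [ne_eq, decide_not, Bool.not_eq_eq_eq_not, Bool.not_true, decide_eq_false_iff_not]
      omega
  · dsimp only
    rcases h.cover z hz with h1 | ⟨M, hM, hzM⟩
    · exact .inl (hu.trans h1)
    · rcases Multiset.mem_add.1 hM with hM | hM
      · rw [hsel] at hM
        rcases Multiset.mem_cons.1 hM with rfl | hM
        · rcases hcover z hzM with h1 | ⟨M', hM', hz'⟩
          · exact .inl (EReal.coe_le_coe_iff.2 h1)
          · exact .inr ⟨M', by simp [hM'], hz'⟩
        · exact .inr ⟨M, by simp [hM], hzM⟩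
      · exact .inr ⟨M, by simp [hM], hzM⟩

theorem Inv.upper_cases (h : Inv A b Q c ε S T σ) :
    σ.upper = ⊤ ∨ ∃ x ∈ polyhedron A b, σ.upper = (quad Q c x : ℝ) :=
  h.upper.imp_left And.left

theorem Inv.step_active (hQ : (-Q).PosSemidef) (hε : 0 < ε) (h : Inv A b Q c ε S T σ)
    (hstep : Step A b Q c ε σ τ) (hactive : σ.active ≠ 0) :
    Inv A b Q c ε S T τ ∧ τ.active.card < σ.active.card := by
  cases hstep with
  | fathom N rest l α u₁ hrun hsel hbound htest =>
    have hl : ∀ z ∈ N.set, l ≤ quad Q c z := fun z hz => hbound.1.le_quad hz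
    refine ⟨?_, by simp [hsel]⟩
    have := h.process (D := 0) hsel hl hbound.upper_le (hbound.exists_eq h.upper_cases) le_rfl
      (by simp) fun z hz => .inl (by linarith [hl z hz])
    simpa using this
  | emptied N rest l α u₁ u₂ N' hrun hsel hbound htest hcut hempty =>
    have hN : N ∈ σ.active := by rw [hsel]; exact Multiset.mem_cons_self _ _
    have hNX := (h.node_set N (Multiset.mem_add.2 (.inl hN))).2
    refine ⟨?_, by simp [hsel]⟩
    have := h.process (D := 0) hsel (fun z hz => hbound.1.le_quad hz)
      ((EReal.coe_le_coe_iff.2 hcut.upper_le).trans hbound.upper_le)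
      (hcut.exists_eq hNX (hbound.exists_eq h.upper_cases)) le_rfl
      (by simp) fun z hz => .inl (hcut.valid hQ hε hNX hz (by simp [hempty]))
    simpa using this
  | branch N rest l α u₁ u₂ N' x d hrun hsel hbound htest hcut hne hcenter hd =>
    have hN : N ∈ σ.active := by rw [hsel]; exact Multiset.mem_cons_self _ _
    have hNX := (h.node_set N (Multiset.mem_add.2 (.inl hN))).2
    refine ⟨?_, by simp [hsel]⟩
    have := h.process (D := N'.child (σ.count + 1) d (d ⬝ᵥ x) ::ₘ
        N'.child (σ.count + 2) (-d) (-(d ⬝ᵥ x)) ::ₘ 0) (k := σ.count + 2) hsel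
      (fun z hz => hbound.1.le_quad hz)
      ((EReal.coe_le_coe_iff.2 hcut.upper_le).trans hbound.upper_le)
      (hcut.exists_eq hNX (hbound.exists_eq h.upper_cases)) (by omega)
      (fun M hM => by
        simp only [Multiset.mem_cons, Multiset.notMem_zero, or_false] at hM
        rcases hM with rfl | rfl
        · exact ⟨⟨x, Node.mem_set_child.2 ⟨le_rfl, hcenter.1⟩⟩,
            fun z hz => hcut.subset (Node.mem_set_child.1 hz).2, Nat.lt_succ_self _,
            Nat.le_succ _, hcut.id_eq⟩
        · exact ⟨⟨x, Node.mem_set_child.2 ⟨by rw [neg_dotProduct], hcenter.1⟩⟩,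
            fun z hz => hcut.subset (Node.mem_set_child.1 hz).2,
            show σ.count < σ.count + 2 by omega, le_rfl, hcut.id_eq⟩)
      fun z hz => by
        by_cases hz' : z ∈ N'.set
        · refine .inr ?_
          rcases le_total (d ⬝ᵥ z) (d ⬝ᵥ x) with h1 | h1
          · exact ⟨_, Multiset.mem_cons_self _ _, Node.mem_set_child.2 ⟨h1, hz'⟩⟩
          · exact ⟨_, Multiset.mem_cons_of_mem (Multiset.mem_cons_self _ _),
              Node.mem_set_child.2 ⟨by rw [neg_dotProduct]; linarith, hz'⟩⟩
        · exact .inl (hcut.valid hQ hε hNX hz hz')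
    simpa using this
  | halt hrun h0 hhalt => exact absurd h0 hactive
  | nextRound hrun h0 hnext => exact absurd h0 hactive

/-- The window `(S, T]` of active numbers moves on to `(T, σ.count]`. The upper bound is finite
here, since `⊤` is allowed only while active nodes remain. -/
theorem Inv.step_round (h : Inv A b Q c ε S T σ) (hstep : Step A b Q c ε σ τ)
    (hactive : σ.active = 0) (hrun : τ.running = true) :
    Inv A b Q c ε T σ.count τ ∧ σ.next ≠ 0 ∧ τ.active = σ.next ∧ τ.next = 0 := by
  cases hstep with
  | fathom N rest l α u₁ hrun hsel hbound htest => simp [hactive] at hsel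
  | emptied N rest l α u₁ u₂ N' hrun hsel hbound htest hcut hempty => simp [hactive] at hsel
  | branch N rest l α u₁ u₂ N' x d hrun hsel hbound htest hcut hne hcenter hd =>
    simp [hactive] at hsel
  | halt hrun' h0 hhalt => simp at hrun
  | nextRound _ h0 hnext =>
    refine ⟨⟨?_, le_rfl, fun N hN => ?_, fun N hN => ?_, by simp, by simp, ?_, fun z hz => ?_⟩,
      hnext, rfl, rfl⟩
    · obtain ⟨N, hN⟩ := Multiset.exists_mem_of_ne_zero hnext
      have := h.next_id N hN
      omega
    · exact h.node_set N (by simpa [hactive] using hN)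
    · have := h.next_id N hN
      exact ⟨this.1, this.2.1, this.2.2.2⟩
    · rcases h.upper with h1 | h1
      · exact absurd hactive h1.2
      · exact .inr h1
    · simpa [hactive] using h.cover z hz

/-- When the algorithm stops, its upper bound is `ε`-optimal. -/
theorem Inv.step_halt (h : Inv A b Q c ε S T σ) (hstep : Step A b Q c ε σ τ)
    (hrun : σ.running = true) (hfin : τ.running = false) :
    ∃ x ∈ polyhedron A b, τ.upper = (quad Q c x : ℝ) ∧
      ∀ z ∈ polyhedron A b, quad Q c x ≤ quad Q c z + ε := by
  cases hstep with
  | fathom => simp_all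
  | emptied => simp_all
  | branch => simp_all
  | nextRound => simp_all
  | halt hrun' hactive hhalt =>
    rcases h.upper with h1 | ⟨x, hx, hux⟩
    · exact absurd hactive h1.2
    refine ⟨x, hx, hux, fun z hz => ?_⟩
    rcases h.cover z hz with h1 | ⟨N, hN, hzN⟩
    · rw [hux] at h1
      exact EReal.coe_le_coe_iff.1 h1
    · rw [hactive, zero_add] at hN
      rcases hhalt with h0 | hgap
      · simp [h0] at hN
      · obtain ⟨l, hl, hlz⟩ := h.next_bound N hN
        have h1 : minBound σ.bounds ≤ (l : EReal) := iInf₂_le (N.father, l) hl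
        have h2 : ((quad Q c x : ℝ) : EReal) ≤ ((l + ε : ℝ) : EReal) := by
          rw [← hux, EReal.coe_add]
          exact hgap.trans (add_le_add_left h1 _)
        linarith [EReal.coe_le_coe_iff.1 h2, hlz z hzN]

theorem Step.running (hstep : Step A b Q c ε σ τ) : σ.running = true := by
  cases hstep <;> assumption

/-! ### The algorithm does not get stuck -/

theorem Inv.exists_step (hQ : (-Q).PosSemidef) (hε : 0 < ε)
    (hb : Bornology.IsBounded (polyhedron A b)) (hne : (polyhedron A b).Nonempty)
    (h : Inv A b Q c ε S T σ) (hrun : σ.running = true) : ∃ τ, Step A b Q c ε σ τ := by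
  by_cases hactive : σ.active = 0
  · by_cases hnext : σ.next = 0
    · exact ⟨_, .halt σ hrun hactive (.inl hnext)⟩
    · exact ⟨_, .nextRound σ hrun hactive hnext⟩
  obtain ⟨N, hN⟩ := Multiset.exists_mem_of_ne_zero hactive
  obtain ⟨rest, hsel⟩ := Multiset.exists_cons_of_mem hN
  obtain ⟨hNne, hNX⟩ := h.node_set N (Multiset.mem_add.2 (.inl hN))
  have hu : σ.upper ≠ ⊥ := by
    rcases h.upper_cases with h1 | ⟨x, -, h1⟩ <;> rw [h1] <;> simp
  obtain ⟨l, α, u₁, hbound⟩ := exists_bounding (c := c) hne hb hQ hu hNne hNX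
  by_cases htest : l + ε < u₁
  · obtain ⟨u₂, N', hcut⟩ := exists_cutting hb hQ c ε u₁ hNne hNX α
    rcases N'.set.eq_empty_or_nonempty with hN' | hN'
    · exact ⟨_, .emptied σ N rest l α u₁ u₂ N' hrun hsel hbound htest hcut hN'⟩
    · obtain ⟨x, hx⟩ := exists_isChebyshevCenter hN'
        (isCompact_polyhedron (hb.subset (hcut.subset.trans hNX)))
      -- For `n = 0` there is no direction `d ≠ 0`, but branching cannot occur: the node is a single
      -- point, its bound is exact, and the test would have fathomed it.
      rcases Nat.eq_zero_or_pos n with rfl | hn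
      · obtain ⟨v, -, hv⟩ := hbound.2
        have h1 : u₁ ≤ quad Q c v := EReal.coe_le_coe_iff.1 (hv ▸ min_le_right _ _)
        have h2 := hbound.1.min_Phi_le hNne (y := v) (le_refl 0)
          (fun z _ => mem_box.2 fun i => i.elim0) hbound.upper_le (by rwa [Phi_zero])
        linarith
      · refine ⟨_, .branch σ N rest l α u₁ u₂ N' x (Pi.single ⟨0, hn⟩ 1) hrun hsel hbound htest
          hcut hN' hx ?_⟩
        simp
  · exact ⟨_, .fathom σ N rest l α u₁ hrun hsel hbound htest⟩

theorem Inv.step (hQ : (-Q).PosSemidef) (hε : 0 < ε) (h : Inv A b Q c ε S T σ)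
    (hstep : Step A b Q c ε σ τ) (hrun : τ.running = true) : ∃ S' T', Inv A b Q c ε S' T' τ := by
  by_cases hactive : σ.active = 0
  · exact ⟨_, _, (h.step_round hstep hactive hrun).1⟩
  · exact ⟨_, _, (h.step_active hQ hε hstep hactive).1⟩

/-! ### Finite convergence -/

/-- Every node whose father has a number from `K` on is close to a point at which the objective
function is not smaller than the upper bound. -/
def NearUpper (A : Matrix (Fin m) (Fin n) ℝ) (b : Fin m → ℝ) (Q : Matrix (Fin n) (Fin n) ℝ)
    (c : Fin n → ℝ) (K : ℕ) (d : Fin n → ℝ) (σ : State n) : Prop :=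
  ∀ N ∈ σ.active + σ.next, K ≤ N.father →
    ∃ v ∈ polyhedron A b, σ.upper ≤ (quad Q c v : ℝ) ∧ N.set ⊆ box v d

/-- Old nodes keep their centers because `u` only decreases. New sons lie inside the father, which
contains the vertex from `Cutting.exists_le` and has diameter below `δ`. -/
theorem NearUpper.step {K : ℕ} {δ : ℝ} (hb : Bornology.IsBounded (polyhedron A b))
    (hsmall : ∀ N ∈ σ.active + σ.next, K ≤ N.id → euclidDiam N.set < δ)
    (hset : ∀ N ∈ σ.active + σ.next, N.set ⊆ polyhedron A b)
    (h : NearUpper A b Q c K (fun _ => δ) σ) (hstep : Step A b Q c ε σ τ) :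
    NearUpper A b Q c K (fun _ => δ) τ := by
  have hmono : ∀ {u : EReal} {N : Node n}, u ≤ σ.upper → N ∈ σ.active + σ.next → K ≤ N.father →
      ∃ v ∈ polyhedron A b, u ≤ (quad Q c v : ℝ) ∧ N.set ⊆ box v fun _ => δ := fun hu hN hK => by
    obtain ⟨v, hv, h1, h2⟩ := h _ hN hK
    exact ⟨v, hv, hu.trans h1, h2⟩
  cases hstep with
  | fathom N rest l α u₁ hrun hsel hbound htest =>
    intro M hM hK
    refine hmono hbound.upper_le ?_ hK
    rw [hsel, Multiset.cons_add]
    exact Multiset.mem_cons_of_mem hM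
  | emptied N rest l α u₁ u₂ N' hrun hsel hbound htest hcut hempty =>
    intro M hM hK
    refine hmono ((EReal.coe_le_coe_iff.2 hcut.upper_le).trans hbound.upper_le) ?_ hK
    rw [hsel, Multiset.cons_add]
    exact Multiset.mem_cons_of_mem hM
  | branch N rest l α u₁ u₂ N' x d hrun hsel hbound htest hcut hne hcenter hd =>
    intro M hM hK
    have hN : N ∈ σ.active + σ.next := by simp [hsel]
    have hchild : ∀ M : Node n, M.set ⊆ N'.set → M.father = N'.id → K ≤ M.father →
        ∃ v ∈ polyhedron A b, (u₂ : EReal) ≤ (quad Q c v : ℝ) ∧ M.set ⊆ box v fun _ => δ :=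
      fun M hM hf hK => by
        obtain ⟨v, hv, huv⟩ := hcut.exists_le
        refine ⟨v, hset N hN hv, EReal.coe_le_coe_iff.2 huv, fun z hz => mem_box.2 fun i => ?_⟩
        have h1 := hsmall N hN (by rwa [← hcut.id_eq, ← hf])
        have h2 := abs_le.1 (abs_sub_le_euclidDiam
          (isCompact_polyhedron (hb.subset (hset N hN))) (hcut.subset (hM hz)) hv i)
        change euclidDiam (polyhedron N.A N.b) < δ at h1
        constructor <;> linarith
    simp only [Multiset.mem_add, Multiset.mem_cons] at hM
    rcases hM with hM | rfl | rfl | hM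
    · exact hmono ((EReal.coe_le_coe_iff.2 hcut.upper_le).trans hbound.upper_le)
        (by simp [hsel, hM]) hK
    · exact hchild _ (fun z hz => (Node.mem_set_child.1 hz).2) rfl hK
    · exact hchild _ (fun z hz => (Node.mem_set_child.1 hz).2) rfl hK
    · exact hmono ((EReal.coe_le_coe_iff.2 hcut.upper_le).trans hbound.upper_le)
        (by simp [hM]) hK
  | halt hrun hactive hhalt => exact h
  | nextRound hrun hactive hnext =>
    intro M hM hK
    exact h M (by simpa [hactive] using hM) hK

/-- The bound of a box around a feasible point is within `ε` of the value at this point if the box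
is small. -/
theorem exists_box_size (hb : Bornology.IsBounded (polyhedron A b)) (hε : 0 < ε) :
    ∃ δ : ℝ, 0 < δ ∧ ∀ v ∈ polyhedron A b, quad Q c v - ε ≤ Phi Q c v fun _ => δ := by
  have hcont : Continuous fun p : ℝ × (Fin n → ℝ) =>
      boxModulus Q c (p.2, fun _ => p.1) (p.2, 0) := by
    unfold boxModulus quad Matrix.mulVec; fun_prop
  have hev : ∀ᶠ δ in 𝓝 (0 : ℝ), ∀ v ∈ polyhedron A b,
      boxModulus Q c (v, fun _ => δ) (v, 0) < ε := by
    refine (isCompact_polyhedron hb).eventually_forall_of_forall_eventually fun v _ => ?_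
    have h0 : Tendsto (fun p : ℝ × (Fin n → ℝ) => boxModulus Q c (p.2, fun _ => p.1) (p.2, 0))
        (𝓝 (0, v)) (𝓝 0) := hcont.tendsto' _ _ (by simp [boxModulus])
    exact h0.eventually_lt_const hε
  obtain ⟨δ, h, hδ⟩ := ((hev.filter_mono nhdsWithin_le_nhds).and
    (self_mem_nhdsWithin (s := Ioi (0 : ℝ)))).exists
  refine ⟨δ, hδ, fun v hv => ?_⟩
  have hδ0 : (0 : Fin n → ℝ) ≤ fun _ => δ := fun _ => (show (0 : ℝ) < δ from hδ).le
  have h1 := Phi_le_add_boxModulus Q c (p := (v, fun _ => δ)) (p' := (v, 0)) hδ0 (le_refl 0)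
  simp only [Phi_zero] at h1
  linarith [h v hv]

/-- A node that is close to a point with value at least the upper bound is fathomed. -/
theorem Bounding.fathomed {u : EReal} {N : Node n} {l : ℝ} {α : Fin N.m → AffineFn n} {u₁ δ : ℝ}
    (h : Bounding A b Q c u N l α u₁) (hε : 0 < ε) (hN : N.set.Nonempty) (hδ : 0 < δ)
    {v : Fin n → ℝ} (hv : quad Q c v - ε ≤ Phi Q c v fun _ => δ) (huv : u ≤ (quad Q c v : ℝ))
    (hbox : N.set ⊆ box v fun _ => δ) : ¬ l + ε < u₁ := by
  have h1 : u₁ ≤ quad Q c v := EReal.coe_le_coe_iff.1 (h.upper_le.trans huv)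
  -- The candidate `u₁ - ε` satisfies the cap `ℓ ≤ u`, so this covers the case where the cap lies
  -- below the box bound.
  have h2 := h.1.min_Phi_le hN (y := v) (d := fun _ => δ) (fun _ => hδ.le) hbox (r := u₁ - ε)
    ((EReal.coe_le_coe_iff.2 (by linarith)).trans h.upper_le) (by linarith)
  linarith

end

/-! ### Runs that never stop, and the contradiction -/

section

variable {σ : ℕ → State n}

theorem IsRun.step (h : IsRun A b Q c ε σ) {k : ℕ} (hk : (σ k).running = true) :
    Step A b Q c ε (σ k) (σ (k + 1)) := by
  rcases h.2 k with h | h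
  · exact h
  · simp [h.1] at hk

theorem IsRun.exists_inv (hQ : (-Q).PosSemidef) (hε : 0 < ε) (hne : (polyhedron A b).Nonempty)
    (h : IsRun A b Q c ε σ) : ∀ k, (σ k).running = true → ∃ S T, Inv A b Q c ε S T (σ k) := by
  intro k
  induction k with
  | zero => intro _; rw [h.1]; exact ⟨0, 1, inv_initState hne⟩
  | succ k ih =>
    intro hk
    rcases h.2 k with hs | ⟨h1, h2⟩
    · obtain ⟨S, T, hI⟩ := ih hs.running
      exact hI.step hQ hε hs hk
    · rw [h2, h1] at hk
      exact absurd hk (by simp)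

theorem IsRun.exists_end_of_round (hQ : (-Q).PosSemidef) (hε : 0 < ε) (h : IsRun A b Q c ε σ)
    (hrun : ∀ k, (σ k).running = true) {S T : ℕ} : ∀ (r k : ℕ), (σ k).active.card ≤ r →
      Inv A b Q c ε S T (σ k) → ∃ k', Inv A b Q c ε S T (σ k') ∧ (σ k').active = 0 := by
  intro r
  induction r with
  | zero => exact fun k hr hI => ⟨k, hI, Multiset.card_eq_zero.1 (Nat.le_zero.1 hr)⟩
  | succ r ih =>
    intro k hr hI
    by_cases h0 : (σ k).active = 0
    · exact ⟨k, hI, h0⟩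
    · obtain ⟨h1, h2⟩ := hI.step_active hQ hε (h.step (hrun k)) h0
      exact ih (k + 1) (by omega) h1

/-- Every round ends, since each processing step removes an active node; closing it raises the lower
end of the number window by at least one. -/
theorem IsRun.exists_late_round (hQ : (-Q).PosSemidef) (hε : 0 < ε)
    (hne : (polyhedron A b).Nonempty) (h : IsRun A b Q c ε σ)
    (hrun : ∀ k, (σ k).running = true) (R : ℕ) :
    ∃ k S T, R ≤ S ∧ Inv A b Q c ε S T (σ k) := by
  induction R with
  | zero => exact ⟨0, 0, 1, le_rfl, by rw [h.1]; exact inv_initState hne⟩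
  | succ R ih =>
    obtain ⟨k, S, T, hR, hI⟩ := ih
    obtain ⟨k', hI', h0⟩ := h.exists_end_of_round hQ hε hrun _ k le_rfl hI
    have := hI'.lt
    exact ⟨k' + 1, T, _, by omega, (hI'.step_round (h.step (hrun k')) h0 (hrun _)).1⟩

theorem IsRun.nearUpper (hQ : (-Q).PosSemidef) (hε : 0 < ε) (hne : (polyhedron A b).Nonempty)
    (hb : Bornology.IsBounded (polyhedron A b)) (h : IsRun A b Q c ε σ)
    (hrun : ∀ k, (σ k).running = true) {K : ℕ} (hK : 0 < K) {δ : ℝ}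
    (hsmall : ∀ k, ∀ N ∈ (σ k).active + (σ k).next, K ≤ N.id → euclidDiam N.set < δ) (k : ℕ) :
    NearUpper A b Q c K (fun _ => δ) (σ k) := by
  induction k with
  | zero =>
    intro N hN hKN
    rw [h.1] at hN
    simp only [initState, add_zero, Multiset.mem_singleton] at hN
    subst hN
    exact absurd hKN (Nat.not_le.2 hK)
  | succ k ih =>
    obtain ⟨S, T, hI⟩ := h.exists_inv hQ hε hne k (hrun k)
    exact ih.step hb (hsmall k) (fun N hN => (hI.node_set N hN).2) (h.step (hrun k))

/-- A run does not go on after a round in which all nodes are fathomed. -/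
theorem IsRun.not_all_fathomed (hQ : (-Q).PosSemidef) (hε : 0 < ε) (h : IsRun A b Q c ε σ)
    (hrun : ∀ k, (σ k).running = true) {P : Node n → Prop}
    (hP : ∀ k, ∀ N ∈ (σ k).active, P N → ∀ l α u₁,
      Bounding A b Q c (σ k).upper N l α u₁ → ¬ l + ε < u₁) {S T : ℕ} :
    ∀ (r k : ℕ), (σ k).active.card ≤ r → Inv A b Q c ε S T (σ k) → (σ k).next = 0 →
      ¬ ∀ N ∈ (σ k).active, P N := by
  have hend : ∀ k, Inv A b Q c ε S T (σ k) → (σ k).active = 0 → (σ k).next ≠ 0 := fun k hI h0 =>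
    (hI.step_round (h.step (hrun k)) h0 (hrun _)).2.1
  intro r
  induction r with
  | zero =>
    exact fun k hr hI hnext _ => hend k hI (Multiset.card_eq_zero.1 (Nat.le_zero.1 hr)) hnext
  | succ r ih =>
    intro k hr hI hnext hall
    by_cases h0 : (σ k).active = 0
    · exact hend k hI h0 hnext
    have hs := h.step (hrun k)
    obtain ⟨h1, h2⟩ := hI.step_active hQ hε hs h0
    have key : (σ (k + 1)).next = 0 ∧ ∀ N ∈ (σ (k + 1)).active, N ∈ (σ k).active := by
      have hPk := hP k
      revert hs
      generalize σ (k + 1) = τ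
      intro hs
      cases hs with
      | fathom N rest l α u₁ hrun hsel hbound htest =>
        exact ⟨hnext, fun M hM => by rw [hsel]; exact Multiset.mem_cons_of_mem hM⟩
      | emptied N rest l α u₁ u₂ N' hrun hsel hbound htest hcut hempty =>
        have hN : N ∈ (σ k).active := by rw [hsel]; exact Multiset.mem_cons_self _ _
        exact absurd htest (hPk N hN (hall N hN) l α u₁ hbound)
      | branch N rest l α u₁ u₂ N' x d hrun hsel hbound htest hcut hne hcenter hd =>
        have hN : N ∈ (σ k).active := by rw [hsel]; exact Multiset.mem_cons_self _ _
        exact absurd htest (hPk N hN (hall N hN) l α u₁ hbound)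
      | halt hrun hactive hhalt => exact absurd hactive h0
      | nextRound hrun hactive hnext => exact absurd hactive h0
    exact ih (k + 1) (by omega) h1 key.1 fun N hN => hall N (key.2 N hN)

theorem IsRun.exists_stopped (hQ : (-Q).PosSemidef) (hε : 0 < ε) (hne : (polyhedron A b).Nonempty)
    (hb : Bornology.IsBounded (polyhedron A b)) (h : IsRun A b Q c ε σ)
    (hdiam : DiametersTendToZero σ) : ∃ k, (σ k).running = false := by
  by_contra hcon
  have hrun : ∀ k, (σ k).running = true := fun k => by
    by_contra hk
    exact hcon ⟨k, by simpa using hk⟩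
  obtain ⟨δ, hδ, hbox⟩ := exists_box_size (Q := Q) (c := c) hb hε
  obtain ⟨K₀, hK₀⟩ := hdiam δ hδ
  -- The shift to `K₀ + 1` makes the threshold positive, which excludes the root, whose father has
  -- number `0`.
  have hnear := h.nearUpper hQ hε hne hb hrun (K := K₀ + 1) (Nat.succ_pos _) (δ := δ)
    fun k N hN hK => hK₀ k N hN (by omega)
  obtain ⟨k, S, T, hS, hI⟩ := h.exists_late_round hQ hε hne hrun (K₀ + 1)
  obtain ⟨k', hI', h0⟩ := h.exists_end_of_round hQ hε hrun _ k le_rfl hI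
  obtain ⟨h1, -, h3, h4⟩ := hI'.step_round (h.step (hrun k')) h0 (hrun _)
  refine h.not_all_fathomed hQ hε hrun (P := fun N => K₀ + 1 ≤ N.father)
    (fun j N hN hK l α u₁ hbound => ?_) _ (k' + 1) le_rfl h1 h4 fun N hN => ?_
  · have hmem : N ∈ (σ j).active + (σ j).next := Multiset.mem_add.2 (.inl hN)
    obtain ⟨v, hv, huv, hsub⟩ := hnear j N hmem hK
    obtain ⟨S', T', hJ⟩ := h.exists_inv hQ hε hne j (hrun j)
    exact hbound.fathomed hε (hJ.node_set N hmem).1 hδ (hbox v hv) huv hsub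
  · rw [h3] at hN
    have := hI'.next_id N hN
    omega

end

end

end ConcaveQP

theorem mainTheorem2 {n m : ℕ} (A : Matrix (Fin m) (Fin n) ℝ) (b : Fin m → ℝ)
    (Q : Matrix (Fin n) (Fin n) ℝ) (c : Fin n → ℝ)
    (hQ : (-Q).PosSemidef)
    (hbdd : Bornology.IsBounded (ConcaveQP.polyhedron A b))
    (hint : (interior (ConcaveQP.polyhedron A b)).Nonempty) :
    -- the box bound is a well-defined maximum, is exact for singletons, and is continuous
    (∀ y d : Fin n → ℝ, 0 ≤ d →
      IsGreatest (ConcaveQP.boxFeasible Q c y d) (ConcaveQP.Phi Q c y d)) ∧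
    (∀ y : Fin n → ℝ, ConcaveQP.Phi Q c y 0 = y ⬝ᵥ Q.mulVec y + 2 * (c ⬝ᵥ y)) ∧
    ContinuousOn (fun p : (Fin n → ℝ) × (Fin n → ℝ) => ConcaveQP.Phi Q c p.1 p.2)
      (ConcaveQP.polyhedron A b ×ˢ {d | 0 ≤ d}) ∧
    ∀ ε : ℝ, 0 < ε →
      -- the algorithm never gets stuck before it stops
      (∀ σ, Relation.ReflTransGen (ConcaveQP.Step A b Q c ε) (ConcaveQP.initState A b) σ →
        σ.running = true → ∃ τ, ConcaveQP.Step A b Q c ε σ τ) ∧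
      -- every run in which the diameters tend to zero stops, with an `ε`-optimal upper bound
      (∀ σ : ℕ → ConcaveQP.State n, ConcaveQP.IsRun A b Q c ε σ →
        ConcaveQP.DiametersTendToZero σ →
        ∃ k, (σ k).running = false ∧
          ∃ x ∈ ConcaveQP.polyhedron A b, (σ k).upper = (ConcaveQP.quad Q c x : ℝ) ∧
            ∀ z ∈ ConcaveQP.polyhedron A b, ConcaveQP.quad Q c x ≤ ConcaveQP.quad Q c z + ε) := by
  have hne := hint.mono interior_subset
  refine ⟨fun y d hd => ConcaveQP.Phi_isGreatest Q c y hd, ConcaveQP.Phi_zero Q c,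
    ConcaveQP.Phi_continuousOn Q c _, fun ε hε => ⟨fun σ hσ hrun => ?_, fun σ hσ hdiam => ?_⟩⟩
  · have hinv : σ.running = true → ∃ S T, ConcaveQP.Inv A b Q c ε S T σ := by
      clear hrun
      induction hσ with
      | refl => exact fun _ => ⟨0, 1, ConcaveQP.inv_initState hne⟩
      | tail _ hstep ih =>
        intro hrun
        obtain ⟨S, T, hI⟩ := ih hstep.running
        exact hI.step hQ hε hstep hrun
    obtain ⟨S, T, hI⟩ := hinv hrun
    exact hI.exists_step hQ hε hbdd hne hrun
  · classical
    have hfin := hσ.exists_stopped hQ hε hne hbdd hdiam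
    -- At the first stopped index the preceding state is still running, so it satisfies the
    -- invariants and the step taken from it is the halting one.
    have hk := Nat.find_spec hfin
    have hmin := fun j => Nat.find_min hfin (m := j)
    revert hk hmin
    generalize Nat.find hfin = k
    intro hk hmin
    cases k with
    | zero => simp [hσ.1, ConcaveQP.initState] at hk
    | succ k =>
      have hrun : (σ k).running = true := by simpa using hmin k (Nat.lt_succ_self k)
      obtain ⟨S, T, hI⟩ := hσ.exists_inv hQ hε hne k hrun
      exact ⟨k + 1, hk, hI.step_halt (hσ.step hrun) hrun hk⟩
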